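/- **Notation.** Let $T$ be a compact (Hausdorff) abelian group, let $\mathbb Z_2=\{1,-1\}$, and let $G=T\rtimes\mathbb Z_2$ be the compact group $T\times\mathbb Z_2$ with the product topology and the multiplication $(s,a)(t,b)=(st^a,ab)$. Haar measures of compact groups are normalised to have total mass $1$. $L^1(G)$ is the convolution algebra of $G$ and $\mathrm{ZL}^1(G)$ is its centre. A Banach algebra $A$ is *amenable* if it has a bounded approximate diagonal, i.e. a bounded net $(m_\alpha)$ in the projective tensor product $A\hat\otimes A$ such that, for all $a\in A$, $m(m_\alpha)a\to a$, $a\,m(m_\alpha)\to a$ and $a\cdot m_\alpha-m_\alpha\cdot a\to 0$ in norm, where $m:A\hat\otimes A\to A$ is the multiplication map, $a\cdot(b\otimes c)=(ab)\otimes c$ and $(b\otimes c)\cdot a=b\otimes(ca)$. Let $\sigma:G\to\{1,-1\}$, $\sigma(s,a)=a$, and let $\mu_T$ be the complex Radon measure on $G\times G$ $$\mu_T=\bigl(1\otimes1+\sigma\otimes\sigma-2(1+\sigma)\otimes(1+\sigma)\bigr)+\lambda_D+\lambda_A,$$ where a function stands for the measure with that density with respect to the Haar measure of $G\times G$, and $\lambda_D$,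 $\lambda_A$ are the normalised Haar measures of the subgroups $D=\{((t,1),(t,1)):t\in T\}$ and $A=\{((t,1),(t^{-1},1)):t\in T\}$ of $G\times G$. For irreducible (continuous, finite-dimensional) unitary representations $\pi,\rho$ of $G$ with normalised characters $\psi_\pi=\frac1{\dim\pi}\operatorname{Tr}\pi$, $\psi_\rho=\frac1{\dim\rho}\operatorname{Tr}\rho$, put $$\hat\mu_T(\pi\times\rho)=\int_{G\times G}\overline{\psi_\pi(x)\psi_\rho(y)}\,d\mu_T(x,y).$$ **Theorem.** Let $T=\mathbb T=\{s\in\mathbb C:|s|=1\}$, or, more generally, let $T$ be any compact abelian group whose only real-valued continuous character $\chi:T\to\mathbb T$ is $\chi=1$. Then $\mathrm{ZL}^1(T\rtimes\mathbb Z_2)$ is amenable. Moreover, $\mu_T$ belongs to the centre of the measure algebra $M(G\times G)$, and for all irreducible unitary representations $\pi,\rho$ of $G$, $\hat\mu_T(\pi\times\rho)=1$ if $\pi$ and $\rho$ are equivalent, and $\hat\mu_T(\pi\times\rho)=0$ otherwise. -/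

import Mathlib

open MeasureTheory Filter Topology
open scoped SemidirectProduct ComplexConjugate

universe u

namespace CentreGroupAlgebra

/-! ## Amenability of Banach algebras -/

section Amenable

/-- The projective tensor product `A ⊗̂ A`: the completion of the algebraic tensor product
`A ⊗ A` (the tensor power indexed by `Fin 2`) in the projective tensor norm
`‖x‖ = inf {∑ ‖aⱼ‖ ‖bⱼ‖ : x = ∑ aⱼ ⊗ bⱼ}`. -/
abbrev ProjTensor (A : Type u) [NonUnitalNormedRing A] [NormedSpace ℂ A] : Type u :=
  UniformSpace.Completion (PiTensorProduct ℂ (fun _ : Fin 2 => A))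

variable (A : Type u) [NonUnitalNormedRing A] [NormedSpace ℂ A]

/-- The inclusion of the algebraic tensor product in the projective tensor product. -/
noncomputable def toProj :
    PiTensorProduct ℂ (fun _ : Fin 2 => A) →L[ℂ] ProjTensor A :=
  UniformSpace.Completion.toComplL

theorem denseRange_toProj : DenseRange (toProj A) :=
  UniformSpace.Completion.denseRange_coe

theorem isUniformInducing_toProj : IsUniformInducing (toProj A) :=
  UniformSpace.Completion.isUniformInducing_coe _

variable {A}

/-- The elementary tensor `b ⊗ c` in `A ⊗̂ A`. -/
noncomputable def elem (b c : A) : ProjTensor A :=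
  toProj A (PiTensorProduct.tprod ℂ ![b, c])

/-- For bounded linear maps `S, T` on `A`, the bounded linear map `S ⊗ T` on `A ⊗̂ A`. -/
noncomputable def tensorMap (S T : A →L[ℂ] A) : ProjTensor A →L[ℂ] ProjTensor A :=
  ContinuousLinearMap.extend
    ((toProj A).comp (PiTensorProduct.mapL (E := fun _ : Fin 2 => A) (E' := fun _ : Fin 2 => A)
      ![S, T]))
    (toProj A)

theorem tensorMap_elem (S T : A →L[ℂ] A) (b c : A) :
    tensorMap S T (elem b c) = elem (S b) (T c) := by
  rw [tensorMap, elem, ContinuousLinearMap.extend_eq _ (denseRange_toProj A)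
    (isUniformInducing_toProj A)]
  simp only [ContinuousLinearMap.comp_apply, PiTensorProduct.mapL_apply,
    PiTensorProduct.map_tprod, elem]
  congr 2
  funext i
  fin_cases i <;> rfl

variable [IsScalarTower ℂ A A] [SMulCommClass ℂ A A]

variable (A) in
/-- The product of `A` as a continuous bilinear map. -/
noncomputable def mulMultilinear : ContinuousMultilinearMap ℂ (fun _ : Fin 2 => A) A :=
  MultilinearMap.mkContinuous
    { toFun := fun v => v 0 * v 1
      map_update_add' := by
        intro _ v i x y
        fin_cases i <;> simp [add_mul, mul_add]
      map_update_smul' := by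
        intro _ v i c x
        fin_cases i <;> simp [smul_mul_assoc, mul_smul_comm] }
    1 (fun v => by simpa using norm_mul_le (v 0) (v 1))

variable (A) in
/-- The multiplication map `m : A ⊗̂ A → A`, `m (b ⊗ c) = b c`. -/
noncomputable def mulMap [CompleteSpace A] : ProjTensor A →L[ℂ] A :=
  ContinuousLinearMap.extend (PiTensorProduct.liftIsometry ℂ _ A (mulMultilinear A)) (toProj A)

theorem mulMap_elem [CompleteSpace A] (b c : A) : mulMap A (elem b c) = b * c := by
  rw [mulMap, elem, ContinuousLinearMap.extend_eq _ (denseRange_toProj A)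
    (isUniformInducing_toProj A)]
  simp [mulMultilinear]

/-- The left module action `a · (b ⊗ c) = (a b) ⊗ c` on `A ⊗̂ A`. -/
noncomputable def leftAct (a : A) : ProjTensor A →L[ℂ] ProjTensor A :=
  tensorMap (ContinuousLinearMap.mul ℂ A a) (ContinuousLinearMap.id ℂ A)

/-- The right module action `(b ⊗ c) · a = b ⊗ (c a)` on `A ⊗̂ A`. -/
noncomputable def rightAct (a : A) : ProjTensor A →L[ℂ] ProjTensor A :=
  tensorMap (ContinuousLinearMap.id ℂ A) ((ContinuousLinearMap.mul ℂ A).flip a)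

theorem leftAct_elem (a b c : A) : leftAct a (elem b c) = elem (a * b) c := by
  simp [leftAct, tensorMap_elem]

theorem rightAct_elem (a b c : A) : rightAct a (elem b c) = elem b (c * a) := by
  simp [rightAct, tensorMap_elem]

variable (A) in
/-- A Banach algebra `A` is amenable if it has a bounded approximate diagonal: a bounded net
`(M i)` in `A ⊗̂ A` with `m (M i) a → a`, `a m (M i) → a` and `a · M i - M i · a → 0` for every
`a` in `A`. -/
def IsAmenable [CompleteSpace A] : Prop :=
  ∃ (ι : Type u) (_ : Preorder ι) (_ : IsDirectedOrder ι) (_ : Nonempty ι) (M : ι → ProjTensor A),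
    (∃ C : ℝ, ∀ i, ‖M i‖ ≤ C) ∧
    ∀ a : A,
      Tendsto (fun i => mulMap A (M i) * a) atTop (𝓝 a) ∧
      Tendsto (fun i => a * mulMap A (M i)) atTop (𝓝 a) ∧
      Tendsto (fun i => leftAct a (M i) - rightAct a (M i)) atTop (𝓝 0)

end Amenable

/-! ## The group algebra of a compact group and its centre -/

section GroupAlgebra

variable (G : Type u) [Group G] [TopologicalSpace G] [IsTopologicalGroup G] [CompactSpace G]
  [MeasurableSpace G] [BorelSpace G]

/-- The Haar measure of total mass one on a compact group. -/
noncomputable def probHaar : Measure G :=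
  Measure.haarMeasure (⊤ : TopologicalSpace.PositiveCompacts G)

instance : (probHaar G).IsHaarMeasure := by
  unfold probHaar; infer_instance

instance : IsProbabilityMeasure (probHaar G) :=
  ⟨by simpa [probHaar] using
    Measure.haarMeasure_self (K₀ := (⊤ : TopologicalSpace.PositiveCompacts G))⟩

/-- The Banach space `L¹(G)` of (classes of) Haar integrable functions. -/
def L1 : Type u := Lp ℂ 1 (probHaar G)

noncomputable instance : NormedAddCommGroup (L1 G) :=
  inferInstanceAs (NormedAddCommGroup (Lp ℂ 1 (probHaar G)))

noncomputable instance : NormedSpace ℂ (L1 G) :=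
  inferInstanceAs (NormedSpace ℂ (Lp ℂ 1 (probHaar G)))

instance : CompleteSpace (L1 G) :=
  inferInstanceAs (CompleteSpace (Lp ℂ 1 (probHaar G)))

/-- The identification of `L1 G` with Mathlib's space `Lp ℂ 1`. -/
noncomputable def L1.toLp : L1 G ≃ₗᵢ[ℂ] Lp ℂ 1 (probHaar G) :=
  LinearIsometryEquiv.refl ℂ (Lp ℂ 1 (probHaar G))

variable {G}

/-- A function representing a class in `L¹(G)`. -/
noncomputable def L1.fn (f : L1 G) : G → ℂ := ⇑(L1.toLp G f)

theorem L1.integrable_fn (f : L1 G) : Integrable f.fn (probHaar G) :=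
  MeasureTheory.L1.integrable_coeFn (L1.toLp G f)

theorem L1.norm_eq (f : L1 G) : ‖f‖ = ∫ t, ‖f.fn t‖ ∂(probHaar G) := by
  rw [← (L1.toLp G).norm_map f, MeasureTheory.L1.norm_eq_integral_norm]
  rfl

theorem L1.fn_add (f g : L1 G) : (f + g).fn =ᵐ[probHaar G] fun t => f.fn t + g.fn t := by
  unfold L1.fn
  rw [map_add]
  exact Lp.coeFn_add _ _

theorem L1.fn_smul (c : ℂ) (f : L1 G) : (c • f).fn =ᵐ[probHaar G] fun t => c * f.fn t := by
  unfold L1.fn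
  rw [map_smul]
  exact Lp.coeFn_smul _ _

/-- Left translation on `L¹(G)`: `translate t f` is the class of `s ↦ f (t⁻¹ s)`. -/
noncomputable def translate (t : G) : L1 G →ₗᵢ[ℂ] L1 G where
  toFun f := (L1.toLp G).symm (DomMulAct.mk t⁻¹ • L1.toLp G f)
  map_add' f g := by rw [map_add, DomMulAct.smul_Lp_add, map_add]
  map_smul' c f := by
    have h : DomMulAct.mk t⁻¹ • L1.toLp G (c • f) = c • (DomMulAct.mk t⁻¹ • L1.toLp G f) := by
      rw [map_smul (L1.toLp G) c f, smul_comm]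
    rw [h]
    exact (L1.toLp G).symm.map_smul c _
  norm_map' f := by
    change ‖(L1.toLp G).symm (DomMulAct.mk t⁻¹ • L1.toLp G f)‖ = ‖f‖
    rw [LinearIsometryEquiv.norm_map, DomMulAct.norm_smul_Lp, LinearIsometryEquiv.norm_map]

theorem fn_translate (t : G) (f : L1 G) :
    (translate t f).fn =ᵐ[probHaar G] fun s => f.fn (t⁻¹ * s) :=
  DomMulAct.smul_Lp_ae_eq (DomMulAct.mk t⁻¹) (L1.toLp G f)

theorem translate_translate (s t : G) (f : L1 G) :
    translate s (translate t f) = translate (s * t) f := by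
  change (L1.toLp G).symm (DomMulAct.mk s⁻¹ • DomMulAct.mk t⁻¹ • L1.toLp G f) =
    (L1.toLp G).symm (DomMulAct.mk (s * t)⁻¹ • L1.toLp G f)
  rw [smul_smul, ← DomMulAct.mk_mul, mul_inv_rev]

theorem continuous_translate (f : L1 G) : Continuous fun t : G => translate t f := by
  have : Fact ((1 : ENNReal) ≠ ⊤) := ⟨ENNReal.one_ne_top⟩
  refine (L1.toLp G).symm.continuous.comp ?_
  have h : Continuous fun t : G => DomMulAct.mk t⁻¹ :=
    DomMulAct.continuous_mk.comp continuous_inv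
  exact h.smul continuous_const

/-- The convolution of `f` and `g` in `L¹(G)`, `f * g = ∫ f(t) (translate t g) dt` as a Bochner
integral in `L¹(G)`; pointwise this is `(f * g)(s) = ∫ f(t) g(t⁻¹ s) dt`. -/
noncomputable def conv (f g : L1 G) : L1 G := ∫ t, f.fn t • translate t g ∂(probHaar G)

theorem integrable_conv (f g : L1 G) :
    Integrable (fun t => f.fn t • translate t g) (probHaar G) :=
  f.integrable_fn.smul_bdd ‖g‖ (continuous_translate g).aestronglyMeasurable_of_compactSpace
    (Eventually.of_forall fun t => ((translate t).norm_map g).le)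

theorem conv_add_left (f f' g : L1 G) : conv (f + f') g = conv f g + conv f' g := by
  unfold conv
  rw [← integral_add (integrable_conv f g) (integrable_conv f' g)]
  refine integral_congr_ae ?_
  filter_upwards [L1.fn_add f f'] with t ht
  rw [ht, add_smul]

theorem conv_add_right (f g g' : L1 G) : conv f (g + g') = conv f g + conv f g' := by
  unfold conv
  rw [← integral_add (integrable_conv f g) (integrable_conv f g')]
  simp only [map_add, smul_add]

theorem conv_smul_left (c : ℂ) (f g : L1 G) : conv (c • f) g = c • conv f g := by
  unfold conv
  rw [← integral_smul]
  refine integral_congr_ae ?_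
  filter_upwards [L1.fn_smul c f] with t ht
  rw [ht, mul_smul]

theorem conv_smul_right (c : ℂ) (f g : L1 G) : conv f (c • g) = c • conv f g := by
  unfold conv
  rw [← integral_smul]
  simp only [map_smul, smul_comm c]

theorem norm_conv_le (f g : L1 G) : ‖conv f g‖ ≤ ‖f‖ * ‖g‖ := by
  refine (norm_integral_le_integral_norm _).trans_eq ?_
  simp only [norm_smul, LinearIsometry.norm_map]
  rw [integral_mul_const, ← L1.norm_eq]

/-- Convolution on the right by a fixed element, as a bounded linear map. -/
noncomputable def convRight (g : L1 G) : L1 G →L[ℂ] L1 G :=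
  LinearMap.mkContinuous
    { toFun := fun f => conv f g
      map_add' := fun f f' => conv_add_left f f' g
      map_smul' := fun c f => conv_smul_left c f g }
    ‖g‖ (fun f => by simpa [mul_comm] using norm_conv_le f g)

theorem translate_conv (t : G) (f g : L1 G) :
    translate t (conv f g) = conv (translate t f) g := by
  have h1 : translate t (conv f g) =
      ∫ s, (translate t).toContinuousLinearMap (f.fn s • translate s g) ∂(probHaar G) :=
    ((translate t).toContinuousLinearMap.integral_comp_comm (integrable_conv f g)).symm
  have h2 : conv (translate t f) g = ∫ s, f.fn (t⁻¹ * s) • translate s g ∂(probHaar G) := by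
    refine integral_congr_ae ?_
    filter_upwards [fn_translate t f] with s hs
    rw [hs]
  rw [h1, h2, ← integral_mul_left_eq_self (fun s => f.fn (t⁻¹ * s) • translate s g) t]
  simp [translate_translate]

theorem conv_assoc (f g h : L1 G) : conv (conv f g) h = conv f (conv g h) := by
  have h1 : conv (conv f g) h =
      ∫ t, convRight h (f.fn t • translate t g) ∂(probHaar G) :=
    ((convRight h).integral_comp_comm (integrable_conv f g)).symm
  rw [h1]
  refine integral_congr_ae (Eventually.of_forall fun t => ?_)
  simp only [map_smul]
  rw [translate_conv]
  rfl

/-- `L¹(G)` with convolution as multiplication is a Banach algebra. -/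
noncomputable instance : NonUnitalNormedRing (L1 G) :=
  { (inferInstance : NormedAddCommGroup (L1 G)) with
    mul := conv
    left_distrib := conv_add_right
    right_distrib := conv_add_left
    zero_mul := fun f => by
      have h : conv 0 f = 0 := by simpa using conv_smul_left (0 : ℂ) 0 f
      exact h
    mul_zero := fun f => by
      have h : conv f 0 = 0 := by simpa using conv_smul_right (0 : ℂ) f 0
      exact h
    mul_assoc := conv_assoc
    norm_mul_le := norm_conv_le }

theorem L1.mul_def (f g : L1 G) : f * g = ∫ t, f.fn t • translate t g ∂(probHaar G) := rfl

instance : IsScalarTower ℂ (L1 G) (L1 G) := ⟨fun c f g => conv_smul_left c f g⟩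

instance : SMulCommClass ℂ (L1 G) (L1 G) := ⟨fun c f g => (conv_smul_right c f g).symm⟩

variable (G)

/-- `ZL¹(G)`, the centre of the group algebra `L¹(G)`. -/
noncomputable abbrev ZL1 : NonUnitalSubalgebra ℂ (L1 G) := NonUnitalSubalgebra.center ℂ (L1 G)

theorem mem_ZL1_iff (f : L1 G) : f ∈ ZL1 G ↔ ∀ g : L1 G, f * g = g * f := by
  rw [NonUnitalSubalgebra.mem_center_iff]
  exact forall_congr' fun g => eq_comm

theorem isClosed_ZL1 : IsClosed (ZL1 G : Set (L1 G)) := by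
  have h : (ZL1 G : Set (L1 G)) = ⋂ g : L1 G, {f | f * g = g * f} := by
    ext f
    simp only [SetLike.mem_coe, mem_ZL1_iff, Set.mem_iInter, Set.mem_ofPred_eq]
  rw [h]
  exact isClosed_iInter fun g => isClosed_eq (by fun_prop) (by fun_prop)

noncomputable instance : NormedSpace ℂ (ZL1 G) where
  norm_smul_le c f := norm_smul_le c (f : L1 G)

instance : CompleteSpace (ZL1 G) := (isClosed_ZL1 G).completeSpace_coe

end GroupAlgebra

/-! ## Radon measures on compact spaces -/

section RadonMeasures

/-- The space `M(K)` of complex Radon measures on a compact space, identified by the Riesz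
representation theorem with the dual of `C(K)`: `μ u` stands for `∫ u dμ`. -/
abbrev RadonMeasure (K : Type*) [TopologicalSpace K] [CompactSpace K] : Type _ :=
  C(K, ℂ) →L[ℂ] ℂ

variable {K L : Type*} [TopologicalSpace K] [CompactSpace K] [TopologicalSpace L] [CompactSpace L]

/-- The image measure: `∫ u d(f_* μ) = ∫ u ∘ f dμ`. -/
noncomputable def pushforward (f : C(K, L)) (μ : RadonMeasure K) : RadonMeasure L :=
  μ.comp
    ({ toFun := fun u => u.comp f
       map_add' := fun _ _ => rfl
       map_smul' := fun _ _ => rfl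
       cont := ContinuousMap.continuous_precomp f } : C(L, ℂ) →L[ℂ] C(K, ℂ))

/-- The measure with density `w` with respect to `μ`: `∫ u d(w μ) = ∫ w u dμ`. -/
noncomputable def withDensity (w : C(K, ℂ)) (μ : RadonMeasure K) : RadonMeasure K :=
  μ.comp (ContinuousLinearMap.mul ℂ C(K, ℂ) w)

/-- The product measure: `∫ u d(μ × ν) = ∫ (∫ u(x, y) dν(y)) dμ(x)`. -/
noncomputable def prodMeasure [T2Space K] [T2Space L] (μ : RadonMeasure K) (ν : RadonMeasure L) : RadonMeasure (K × L) :=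
  μ.comp ((ContinuousLinearMap.compLeftContinuous ℂ K ν).comp
    ({ toFun := fun u => u.curry
       map_add' := fun _ _ => rfl
       map_smul' := fun _ _ => rfl
       cont := ContinuousMap.continuous_curry } : C(K × L, ℂ) →L[ℂ] C(K, C(L, ℂ))))

/-- The convolution of measures on a compact group:
`∫ u d(μ * ν) = ∫ ∫ u(x y) dν(y) dμ(x)`. -/
noncomputable def convMeasure {H : Type*} [Group H] [TopologicalSpace H] [IsTopologicalGroup H]
    [CompactSpace H] [T2Space H] (μ ν : RadonMeasure H) : RadonMeasure H :=
  pushforward ⟨fun p : H × H => p.1 * p.2, continuous_mul⟩ (prodMeasure μ ν)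

/-- `μ` lies in the centre `ZM(H)` of the measure algebra `M(H)`. -/
def IsCentral {H : Type*} [Group H] [TopologicalSpace H] [IsTopologicalGroup H]
    [CompactSpace H] [T2Space H] (μ : RadonMeasure H) : Prop :=
  ∀ ν : RadonMeasure H, convMeasure μ ν = convMeasure ν μ

theorem integrable_probHaar {H : Type u} [Group H] [TopologicalSpace H] [IsTopologicalGroup H]
    [CompactSpace H] [MeasurableSpace H] [BorelSpace H] (u : C(H, ℂ)) :
    Integrable (fun x => u x) (probHaar H) :=
  u.continuous.integrable_of_hasCompactSupport (HasCompactSupport.of_compactSpace _)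

/-- The normalised Haar measure of a compact group (on its Borel sets) as an element of `M(H)`. -/
noncomputable def haarRadon (H : Type u) [Group H] [TopologicalSpace H] [IsTopologicalGroup H]
    [CompactSpace H] : RadonMeasure H :=
  letI : MeasurableSpace H := borel H
  haveI : BorelSpace H := ⟨rfl⟩
  LinearMap.mkContinuous
    { toFun := fun u => ∫ x, u x ∂(probHaar H)
      map_add' := fun u v => integral_add (integrable_probHaar u) (integrable_probHaar v)
      map_smul' := fun c u => integral_smul c _ }
    1 (fun u => by
      have h := norm_integral_le_of_norm_le_const (μ := probHaar H) (f := fun x => u x)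
        (C := ‖u‖) (Eventually.of_forall fun x => u.norm_coe_le_norm x)
      simpa using h)

theorem haarRadon_apply (H : Type u) [Group H] [TopologicalSpace H] [IsTopologicalGroup H]
    [CompactSpace H] [m : MeasurableSpace H] [b : BorelSpace H] (u : C(H, ℂ)) :
    haarRadon H u = ∫ x, u x ∂(probHaar H) := by
  obtain rfl : m = borel H := b.measurable_eq
  rfl

end RadonMeasures

/-! ## Irreducible representations of compact groups -/

section Representations

/-- An irreducible unitary representation of a (compact) group on a finite dimensional complex
Hilbert space, continuous for the topology of the group. -/
structure UnitaryIrrep (H : Type*) [Group H] [TopologicalSpace H] where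
  /-- The dimension `d_π`. -/
  dim : ℕ
  /-- The underlying representation. -/
  rep : Representation ℂ H (EuclideanSpace ℂ (Fin dim))
  norm_map : ∀ g v, ‖rep g v‖ = ‖v‖
  continuous : ∀ v, Continuous fun g => rep g v
  irreducible : rep.IsIrreducible

namespace UnitaryIrrep

variable {H : Type*} [Group H] [TopologicalSpace H]

/-- Equivalence of irreducible representations. -/
def IsEquivalent (π ρ : UnitaryIrrep H) : Prop := Nonempty (π.rep.Equiv ρ.rep)

theorem continuous_character (π : UnitaryIrrep H) : Continuous π.rep.character := by
  have h : π.rep.character = fun g => ∑ i, inner ℂ (EuclideanSpace.basisFun (Fin π.dim) ℂ i)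
      (π.rep g (EuclideanSpace.basisFun (Fin π.dim) ℂ i)) := by
    funext g
    exact LinearMap.trace_eq_sum_inner _ (EuclideanSpace.basisFun (Fin π.dim) ℂ)
  rw [h]
  exact continuous_finsetSum _ fun i _ => continuous_const.inner (π.continuous _)

/-- The normalised character `ψ_π = d_π⁻¹ Tr π(·)`. -/
noncomputable def normChar (π : UnitaryIrrep H) : C(H, ℂ) where
  toFun g := (π.dim : ℂ)⁻¹ * π.rep.character g
  continuous_toFun := continuous_const.mul π.continuous_character

end UnitaryIrrep

/-- The coefficient at `π × ρ` of a measure `μ` on `H × H`,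
`∫ conj (ψ_π(s) ψ_ρ(t)) dμ(s, t)`. Here `π × ρ` is the representation
`(s, t) ↦ π(s) ⊗ ρ(t)` of `H × H`, with normalised character `ψ_π(s) ψ_ρ(t)`. -/
noncomputable def fourierCoeff {H : Type*} [Group H] [TopologicalSpace H]
    [CompactSpace H] (μ : RadonMeasure (H × H)) (π ρ : UnitaryIrrep H) : ℂ :=
  μ ⟨fun p => conj (π.normChar p.1 * ρ.normChar p.2),
    Complex.continuous_conj.comp ((π.normChar.continuous.comp continuous_fst).mul
      (ρ.normChar.continuous.comp continuous_snd))⟩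

end Representations

/-! ## The semidirect product of an abelian group by inversion -/

section SemidirectProduct

/-- The action of `ℤˣ = {1, -1}` on an abelian group `T` by `a · t = t ^ a`. -/
def inversionAction (T : Type*) [CommGroup T] : ℤˣ →* MulAut T where
  toFun a :=
    { toFun := fun t => t ^ (a : ℤ)
      invFun := fun t => t ^ (a : ℤ)
      left_inv := fun t => by
        change (t ^ (a : ℤ)) ^ (a : ℤ) = t
        rw [← zpow_mul, ← Units.val_mul, Int.units_mul_self]; simp
      right_inv := fun t => by
        change (t ^ (a : ℤ)) ^ (a : ℤ) = t
        rw [← zpow_mul, ← Units.val_mul, Int.units_mul_self]; simp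
      map_mul' := fun s t => mul_zpow s t _ }
  map_one' := by ext; simp
  map_mul' a b := by
    ext t
    change t ^ ((a * b : ℤˣ) : ℤ) = (t ^ (b : ℤ)) ^ (a : ℤ)
    rw [← zpow_mul, ← Units.val_mul, mul_comm]

/-- The group `T ⋊ ℤ₂`, where `ℤ₂ = {1, -1}` and `(s, a) (t, b) = (s t ^ a, a b)`. -/
abbrev Dih (T : Type u) [CommGroup T] : Type u := T ⋊[inversionAction T] ℤˣ

variable (T : Type u) [CommGroup T] [TopologicalSpace T]

/-- `T ⋊ ℤ₂` carries the product topology of `T` and the discrete two-point space. -/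
instance : TopologicalSpace (Dih T) :=
  TopologicalSpace.induced SemidirectProduct.equivProd inferInstance

/-- The homeomorphism of `T ⋊ ℤ₂` with the product space. -/
def dihHomeo : Dih T ≃ₜ T × ℤˣ :=
  SemidirectProduct.equivProd.toHomeomorphOfIsInducing ⟨rfl⟩

instance [CompactSpace T] : CompactSpace (Dih T) := (dihHomeo T).symm.compactSpace

instance [T2Space T] : T2Space (Dih T) := (dihHomeo T).symm.t2Space

theorem continuous_left : Continuous fun x : Dih T => x.left :=
  continuous_fst.comp (dihHomeo T).continuous

theorem continuous_right : Continuous fun x : Dih T => x.right :=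
  continuous_snd.comp (dihHomeo T).continuous

theorem continuous_zpow_units [IsTopologicalGroup T] :
    Continuous fun p : T × ℤˣ => p.1 ^ (p.2 : ℤ) := by
  rw [continuous_prod_of_discrete_right]
  intro a
  exact continuous_zpow (a : ℤ)

theorem continuous_dih_mk {X : Type*} [TopologicalSpace X] {f : X → T} {g : X → ℤˣ}
    (hf : Continuous f) (hg : Continuous g) : Continuous fun x => (⟨f x, g x⟩ : Dih T) :=
  (dihHomeo T).symm.continuous.comp (hf.prodMk hg)

instance [IsTopologicalGroup T] : IsTopologicalGroup (Dih T) where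
  continuous_mul := by
    have h : (fun p : Dih T × Dih T => p.1 * p.2) = fun p =>
        (⟨p.1.left * p.2.left ^ (p.1.right : ℤ), p.1.right * p.2.right⟩ : Dih T) := rfl
    rw [h]
    refine continuous_dih_mk T
      (((continuous_left T).comp continuous_fst).mul ((continuous_zpow_units T).comp
        (((continuous_left T).comp continuous_snd).prodMk
          ((continuous_right T).comp continuous_fst))))
      (((continuous_right T).comp continuous_fst).mul ((continuous_right T).comp continuous_snd))
  continuous_inv := by
    have h : (fun p : Dih T => p⁻¹) = fun p =>
        (⟨p.left⁻¹ ^ ((p.right⁻¹ : ℤˣ) : ℤ), p.right⁻¹⟩ : Dih T) := rfl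
    rw [h]
    exact continuous_dih_mk T ((continuous_zpow_units T).comp
      ((continuous_left T).inv.prodMk (continuous_right T).inv)) (continuous_right T).inv

instance : MeasurableSpace (Dih T) := borel _

instance : BorelSpace (Dih T) := ⟨rfl⟩

/-- `T` admits only `1` as a real character: every continuous character `χ : T → 𝕋` with
`conj χ = χ` is trivial. -/
def OnlyTrivialRealCharacter : Prop :=
  ∀ χ : T →ₜ* Circle, (∀ t, conj (χ t : ℂ) = χ t) → ∀ t, χ t = 1

/-- The one-dimensional character `σ(s, a) = a` of `T ⋊ ℤ₂`. -/
noncomputable def sgn : C(Dih T, ℂ) where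
  toFun x := ((x.right : ℤ) : ℂ)
  continuous_toFun :=
    (continuous_of_discreteTopology (f := fun a : ℤˣ => ((a : ℤ) : ℂ))).comp (continuous_right T)

/-- The function `1 ⊗ 1 + σ ⊗ σ - 2 (1 + σ) ⊗ (1 + σ)` on `G × G`, where `G = T ⋊ ℤ₂`. -/
noncomputable def centralDensity : C(Dih T × Dih T, ℂ) where
  toFun p := 1 + sgn T p.1 * sgn T p.2 - 2 * ((1 + sgn T p.1) * (1 + sgn T p.2))
  continuous_toFun := by fun_prop

/-- The embedding `t ↦ ((t, 1), (t, 1))` of `T` in `G × G`, with image the diagonal copy `D`. -/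
def diagEmb : C(T, Dih T × Dih T) where
  toFun t := (⟨t, 1⟩, ⟨t, 1⟩)
  continuous_toFun := (continuous_dih_mk T continuous_id continuous_const).prodMk
    (continuous_dih_mk T continuous_id continuous_const)

/-- The embedding `t ↦ ((t, 1), (t⁻¹, 1))` of `T` in `G × G`, with image the anti-diagonal
copy `A`. -/
def antidiagEmb [IsTopologicalGroup T] : C(T, Dih T × Dih T) where
  toFun t := (⟨t, 1⟩, ⟨t⁻¹, 1⟩)
  continuous_toFun := (continuous_dih_mk T continuous_id continuous_const).prodMk
    (continuous_dih_mk T continuous_inv continuous_const)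

/-- The measure `μ = 1 ⊗ 1 + σ ⊗ σ - 2 (1 + σ) ⊗ (1 + σ) + λ_D + λ_A` on `G × G`, where functions
are regarded as measures through the normalised Haar measure of `G × G`, and `λ_D`, `λ_A` are the
normalised Haar measures of the subgroups `D = {((t, 1), (t, 1))}`, `A = {((t, 1), (t⁻¹, 1))}`. -/
noncomputable def diagonalMeasure [IsTopologicalGroup T] [CompactSpace T] [T2Space T] :
    RadonMeasure (Dih T × Dih T) :=
  withDensity (centralDensity T) (prodMeasure (haarRadon (Dih T)) (haarRadon (Dih T))) +
    pushforward (diagEmb T) (haarRadon T) + pushforward (antidiagEmb T) (haarRadon T)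

end SemidirectProduct

end CentreGroupAlgebra

/-!
Write `G = T ⋊ ℤ₂` and `C_t = ½ (δ_t + δ_{t⁻¹})`, a central measure on `G`. The measure `μ_T` is
invariant under conjugation: a pair of elements of `G` acts on `T × T` by inverting one, both or
none of the coordinates, and so preserves or interchanges `D` and `A`. Measures invariant under
conjugation are central (`isCentral_of_conj_invariant`), and on central elements `λ_D + λ_A` acts
as `2 ∫ C_t ⊗ C_t dt`.

*Squares.* The hypothesis on `T` enters twice. If `t ↦ t ^ 2` were not onto, then `T / T²` would be
a nontrivial compact group of exponent two, and Gelfand theory for its commutative group algebra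
provides a nontrivial character, which is real (`exists_character_of_exponent_two`). The point is
that a continuous real symmetric function has positive spectral radius in `L¹`, as the `L²` norms
of its convolution powers are log-convex. Hence every element of `T` is a square
(`surjective_mul_self`). The hypothesis also says that the only character fixed by inversion is
the trivial one, so that the irreducible representations of `G` are `1`, `σ` and the
two-dimensional representations induced from the characters `χ ≠ 1` of `T`
(`UnitaryIrrep.classification`); orthogonality of the characters of `T` then yields the Fourier
coefficients (`fourierCoeff_eq`).

*Amenability.* Let `e` run over the normalised indicator functions of symmetric neighbourhoods of
the identity in `T`. They form a central approximate identity, and the approximate diagonal is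
`μ_T * (e ⊗ e)`, written as
`1 ⊗ 1 + σ ⊗ σ - 2 (1 + σ) ⊗ (1 + σ) + 2 ∫ (C_t e) ⊗ (C_t e) dt` (`diagTensor`), which is bounded
uniformly in `e`. An element `a` of the centre is invariant under inversion on `T` and, since
conjugation by `(u, 1)` translates the other coset by `u ^ 2`, constant on the other coset; so it
acts as a mean of the `C_t` plus a multiple of `1 - σ` (`central_mul`). As
`C_s C_t = ½ (C_{st} + C_{s⁻¹t})`, invariance of Haar measure moves `C_s` from one tensor factor of
the integral to the other, and the terms with `1` and `σ` balance the remaining part. Hence `a`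
commutes exactly with the tensor (`leftAct_diagTensor`). By `C_t C_t = ½ (C_{t²} + 1)` and the
invariance of Haar measure under squaring, its product is exactly `e * e` (`mulMap_diagTensor`).
-/

namespace CentreGroupAlgebra

/-! ### Weighted integrals of continuous functions -/

section WeightedIntegral

variable {K L E : Type*} [TopologicalSpace K] [CompactSpace K] [MeasurableSpace K] [BorelSpace K]
  [TopologicalSpace L] [NormedAddCommGroup E] [NormedSpace ℂ E]

theorem integrable_smul_continuous {μ : Measure K} {f : K → ℂ} (hf : Integrable f μ)
    {F : K → E} (hF : Continuous F) : Integrable (fun k => f k • F k) μ := by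
  obtain ⟨C, hC⟩ := (isCompact_range hF.norm).bddAbove
  exact hf.smul_bdd C hF.aestronglyMeasurable_of_compactSpace
    (Eventually.of_forall fun k => hC ⟨k, rfl⟩)

theorem integrable_of_continuous {μ : Measure K} [IsFiniteMeasure μ] {F : K → E}
    (hF : Continuous F) : Integrable F μ := by
  simpa using integrable_smul_continuous (integrable_const (1 : ℂ)) hF

theorem integrable_real_of_continuous {μ : Measure K} [IsFiniteMeasure μ] {F : K → ℝ}
    (hF : Continuous F) : Integrable F μ := by
  simpa using (integrable_of_continuous (μ := μ) (Complex.continuous_ofReal.comp hF)).re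

theorem eq_zero_of_integral_norm_sq_eq_zero {μ : Measure K} [IsFiniteMeasure μ]
    [μ.IsOpenPosMeasure] {F : K → ℂ} (hF : Continuous F) (h : ∫ k, ‖F k‖ ^ 2 ∂μ = 0) (k : K) :
    F k = 0 := by
  have hcont : Continuous fun k => ‖F k‖ ^ 2 := hF.norm.pow 2
  have h4 := (integral_eq_zero_iff_of_nonneg (fun k => sq_nonneg ‖F k‖)
    (integrable_real_of_continuous hcont)).1 h
  have h5 := (hcont.ae_eq_iff_eq μ continuous_const).1 h4
  have h6 : ‖F k‖ ^ 2 = 0 := congrFun h5 k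
  exact norm_eq_zero.1 (pow_eq_zero_iff two_ne_zero |>.1 h6)

/-- The bounded functional `F ↦ ∫ f F dμ` on `C(K, E)` given by an integrable weight `f`. -/
noncomputable def weightedIntegral (μ : Measure K) {f : K → ℂ} (hf : Integrable f μ) :
    C(K, E) →L[ℂ] E :=
  LinearMap.mkContinuous
    { toFun := fun F => ∫ k, f k • F k ∂μ
      map_add' := fun F F' => by
        simp only [ContinuousMap.add_apply, smul_add]
        exact integral_add (integrable_smul_continuous hf F.continuous)
          (integrable_smul_continuous hf F'.continuous)
      map_smul' := fun c F => by
        simp only [ContinuousMap.smul_apply, smul_comm _ c, RingHom.id_apply]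
        exact integral_smul c _ }
    (∫ k, ‖f k‖ ∂μ) (fun F => by
      refine (norm_integral_le_integral_norm _).trans ?_
      rw [← integral_mul_const]
      refine integral_mono (integrable_smul_continuous hf F.continuous).norm
        (hf.norm.mul_const _) fun k => ?_
      simp only [norm_smul]
      gcongr
      exact F.norm_coe_le_norm k)

theorem weightedIntegral_apply {μ : Measure K} {f : K → ℂ} (hf : Integrable f μ) (F : C(K, E)) :
    weightedIntegral μ hf F = ∫ k, f k • F k ∂μ := rfl

theorem continuous_integral_smul {μ : Measure K} {f : K → ℂ} (hf : Integrable f μ)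
    {F : L → K → E} (hF : Continuous fun p : L × K => F p.1 p.2) :
    Continuous fun l => ∫ k, f k • F l k ∂μ :=
  (weightedIntegral (E := E) μ hf).continuous.comp
    (ContinuousMap.curry ⟨fun p : L × K => F p.1 p.2, hF⟩).continuous

variable [CompactSpace L] [MeasurableSpace L] [BorelSpace L]

/-- Fubini's theorem for a continuous function on a product of two compact spaces, with an
integrable weight on each factor. The product of the Borel σ-algebras, which may be smaller than
the Borel σ-algebra of the product, plays no role: one side is the image of a Bochner integral
in `C(L, E)` under a bounded linear map. -/
theorem integral_smul_integral_smul_swap [CompleteSpace E] {μ : Measure K} {ν : Measure L}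
    {f : K → ℂ} {g : L → ℂ} (hf : Integrable f μ) (hg : Integrable g ν) {F : K → L → E}
    (hF : Continuous fun p : K × L => F p.1 p.2) :
    ∫ k, f k • ∫ l, g l • F k l ∂ν ∂μ = ∫ l, g l • ∫ k, f k • F k l ∂μ ∂ν := by
  let Φ : C(K, C(L, E)) := ContinuousMap.curry ⟨fun p : K × L => F p.1 p.2, hF⟩
  have hint : Integrable (fun k => f k • Φ k) μ := integrable_smul_continuous hf Φ.continuous
  have h1 := (weightedIntegral (E := E) ν hg).integral_comp_comm hint
  simp only [map_smul, weightedIntegral_apply] at h1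
  refine h1.trans (integral_congr_ae (Eventually.of_forall fun l => ?_))
  have h2 := (ContinuousMap.evalCLM ℂ (M := E) l).integral_comp_comm hint
  simp only at h2 ⊢
  congr 1
  exact h2.symm

/-- Fubini's theorem for continuous functions, unweighted. -/
theorem integral_integral_swap_of_continuous [CompleteSpace E] {μ : Measure K} {ν : Measure L}
    [IsFiniteMeasure μ] [IsFiniteMeasure ν] {F : K → L → E}
    (hF : Continuous fun p : K × L => F p.1 p.2) :
    ∫ k, ∫ l, F k l ∂ν ∂μ = ∫ l, ∫ k, F k l ∂μ ∂ν := by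
  simpa using integral_smul_integral_smul_swap (μ := μ) (ν := ν) (integrable_const (1 : ℂ))
    (integrable_const (1 : ℂ)) hF

theorem integral_smul_integral_swap [CompleteSpace E] {μ : Measure K} {ν : Measure L}
    [IsFiniteMeasure ν] {f : K → ℂ} (hf : Integrable f μ) {F : K → L → E}
    (hF : Continuous fun p : K × L => F p.1 p.2) :
    ∫ k, f k • ∫ l, F k l ∂ν ∂μ = ∫ l, ∫ k, f k • F k l ∂μ ∂ν := by
  simpa using integral_smul_integral_smul_swap (μ := μ) (ν := ν) hf
    (integrable_const (1 : ℂ)) hF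

end WeightedIntegral

/-! ### Pairing integrable functions with continuous functions -/

section Pairing

variable {G : Type u} [Group G] [TopologicalSpace G] [IsTopologicalGroup G] [CompactSpace G]
  [MeasurableSpace G] [BorelSpace G]

/-- Compact groups are unimodular. -/
instance : (probHaar G).IsMulRightInvariant where
  map_mul_right_eq_self g := by
    have : IsProbabilityMeasure ((probHaar G).map (· * g)) :=
      Measure.isProbabilityMeasure_map (by fun_prop)
    exact Measure.isHaarMeasure_eq_of_isProbabilityMeasure _ _

/-- The class in `L¹(G)` of an integrable function. -/
noncomputable def L1.mk (f : G → ℂ) (hf : Integrable f (probHaar G)) : L1 G :=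
  (L1.toLp G).symm (hf.toL1 f)

theorem L1.fn_mk {f : G → ℂ} (hf : Integrable f (probHaar G)) :
    (L1.mk f hf).fn =ᵐ[probHaar G] f := by
  unfold L1.fn L1.mk
  rw [LinearIsometryEquiv.apply_symm_apply]
  exact hf.coeFn_toL1

theorem L1.norm_mk {f : G → ℂ} (hf : Integrable f (probHaar G)) :
    ‖L1.mk f hf‖ = ∫ t, ‖f t‖ ∂(probHaar G) := by
  rw [L1.norm_eq]
  exact integral_congr_ae ((L1.fn_mk hf).fun_comp _)

/-- The pairing of an integrable function with a continuous one. -/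
noncomputable def pair (h : C(G, ℂ)) : L1 G →L[ℂ] ℂ :=
  LinearMap.mkContinuous
    { toFun := fun f => ∫ t, f.fn t * h t ∂(probHaar G)
      map_add' := fun f g => by
        refine Eq.trans ?_ (integral_add (integrable_smul_continuous f.integrable_fn h.continuous)
          (integrable_smul_continuous g.integrable_fn h.continuous))
        refine integral_congr_ae ?_
        filter_upwards [L1.fn_add f g] with t ht
        simp [ht, add_mul]
      map_smul' := fun c f => by
        rw [RingHom.id_apply, ← integral_smul]
        refine integral_congr_ae ?_
        filter_upwards [L1.fn_smul c f] with t ht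
        simp [ht, mul_assoc] }
    ‖h‖ (fun f => by
      refine (norm_integral_le_integral_norm _).trans ?_
      rw [L1.norm_eq, mul_comm, ← integral_mul_const]
      refine integral_mono (integrable_smul_continuous f.integrable_fn h.continuous).norm
        (f.integrable_fn.norm.mul_const _) fun k => ?_
      simp only [norm_mul]
      gcongr
      exact h.norm_coe_le_norm k)

theorem pair_apply (h : C(G, ℂ)) (f : L1 G) : pair h f = ∫ t, f.fn t * h t ∂(probHaar G) := rfl

theorem pair_mk (h : C(G, ℂ)) {f : G → ℂ} (hf : Integrable f (probHaar G)) :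
    pair h (L1.mk f hf) = ∫ t, f t * h t ∂(probHaar G) := by
  rw [pair_apply]
  refine integral_congr_ae ?_
  filter_upwards [L1.fn_mk hf] with t ht
  rw [ht]

theorem norm_pair_le (h : C(G, ℂ)) (f : L1 G) : ‖pair h f‖ ≤ ‖h‖ * ‖f‖ :=
  (pair h).le_of_opNorm_le (LinearMap.mkContinuous_norm_le _ (norm_nonneg _) _) f

theorem L1.exists_continuous_near (f : L1 G) {ε : ℝ} (hε : 0 < ε) :
    ∃ k : C(G, ℂ), ‖f - L1.mk k (integrable_probHaar k)‖ < ε := by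
  obtain ⟨k, hk⟩ := (ContinuousMap.toLp_denseRange ℂ (probHaar G) ℂ
    ENNReal.one_ne_top).exists_dist_lt (L1.toLp G f) hε
  refine ⟨k, ?_⟩
  rw [dist_eq_norm] at hk
  rw [← (L1.toLp G).norm_map, map_sub]
  have : L1.toLp G (L1.mk k (integrable_probHaar k)) = ContinuousMap.toLp 1 (probHaar G) ℂ k := by
    refine Lp.ext ((L1.fn_mk (integrable_probHaar k)).trans ?_)
    exact (ContinuousMap.coeFn_toLp (p := 1) (𝕜 := ℂ) (probHaar G) k).symm
  rwa [this]

/-- An integrable function is determined by its integrals against continuous functions. -/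
theorem L1.eq_zero_of_pair {f : L1 G} (hf : ∀ h : C(G, ℂ), pair h f = 0) : f = 0 := by
  rw [← norm_eq_zero]
  refine le_antisymm (le_of_forall_pos_le_add fun ε hε => ?_) (norm_nonneg f)
  obtain ⟨k, hk⟩ := f.exists_continuous_near (show 0 < ε / 3 by positivity)
  set k' := L1.mk k (integrable_probHaar k) with hk'
  -- a continuous substitute for the conjugate of the sign of `k`
  let h : C(G, ℂ) := ⟨fun t => conj (k t) / ((‖k t‖ + ε / 3 : ℝ) : ℂ), by
    refine Continuous.div (Complex.continuous_conj.comp k.continuous) (by fun_prop) fun t => ?_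
    have : 0 < ‖k t‖ + ε / 3 := by positivity
    exact_mod_cast this.ne'⟩
  have hh : ‖h‖ ≤ 1 := by
    rw [ContinuousMap.norm_le _ zero_le_one]
    intro t
    have : 0 < ‖k t‖ + ε / 3 := by positivity
    simp only [h, ContinuousMap.coe_mk, norm_div, RCLike.norm_conj, Complex.norm_real,
      Real.norm_eq_abs, abs_of_pos this]
    rw [div_le_one this]
    linarith
  have h1 : ‖pair h k'‖ ≤ ε / 3 := by
    have : pair h k' = - pair h (f - k') := by rw [map_sub, hf]; simp
    rw [this, norm_neg]
    calc _ ≤ ‖h‖ * ‖f - k'‖ := norm_pair_le _ _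
      _ ≤ 1 * (ε / 3) := by gcongr
      _ = ε / 3 := one_mul _
  have h2 : ‖k'‖ - ε / 3 ≤ ‖pair h k'‖ := by
    have h3 : pair h k' = ((∫ t, ‖k t‖ ^ 2 / (‖k t‖ + ε / 3) ∂(probHaar G) : ℝ) : ℂ) := by
      rw [hk', pair_mk, ← integral_complex_ofReal]
      refine integral_congr_ae (Eventually.of_forall fun t => ?_)
      simp only [h, ContinuousMap.coe_mk]
      rw [← mul_div_assoc, Complex.mul_conj, Complex.normSq_eq_norm_sq]
      push_cast
      rfl
    rw [h3, Complex.norm_real]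
    refine le_trans ?_ (le_abs_self _)
    have hc : Continuous fun t => ‖k t‖ := k.continuous.norm
    have : ‖k'‖ - ε / 3 = ∫ t, (‖k t‖ - ε / 3) ∂(probHaar G) := by
      rw [integral_sub (integrable_probHaar k).norm (integrable_const _), hk', L1.norm_mk]
      simp
    rw [this]
    refine integral_mono ((integrable_probHaar k).norm.sub (integrable_const _)) ?_ fun t => ?_
    · exact integrable_real_of_continuous
        ((hc.pow 2).div (by fun_prop) fun t => by positivity)
    · simp only
      rw [le_div_iff₀ (by positivity)]
      nlinarith [sq_nonneg (ε / 3)]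
  have h4 : ‖f‖ ≤ ‖f - k'‖ + ‖k'‖ := by simpa using norm_add_le (f - k') k'
  linarith

theorem L1.ext_pair {f g : L1 G} (h : ∀ k : C(G, ℂ), pair k f = pair k g) : f = g := by
  rw [← sub_eq_zero]
  exact L1.eq_zero_of_pair fun k => by rw [map_sub, h, sub_self]

theorem translate_one (f : L1 G) : translate 1 f = f := by
  have e := translate_translate (1 : G) 1 f
  rw [mul_one] at e
  exact (translate (1 : G)).injective e

theorem pair_translate (h : C(G, ℂ)) (t : G) (f : L1 G) :
    pair h (translate t f) = ∫ s, f.fn s * h (t * s) ∂(probHaar G) := by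
  have : pair h (translate t f) = ∫ s, f.fn (t⁻¹ * s) * h s ∂(probHaar G) := by
    refine integral_congr_ae ?_
    filter_upwards [fn_translate t f] with s hs
    rw [hs]
  rw [this, ← integral_mul_left_eq_self _ t]
  simp

theorem pair_mul (h : C(G, ℂ)) (f g : L1 G) :
    pair h (f * g) =
      ∫ t, f.fn t * ∫ s, g.fn s * h (t * s) ∂(probHaar G) ∂(probHaar G) := by
  rw [L1.mul_def, ← (pair h).integral_comp_comm (integrable_conv f g)]
  simp only [map_smul, pair_translate, smul_eq_mul]

theorem pair_mul' (h : C(G, ℂ)) (f g : L1 G) :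
    pair h (f * g) =
      ∫ s, g.fn s * ∫ t, f.fn t * h (t * s) ∂(probHaar G) ∂(probHaar G) := by
  rw [pair_mul]
  exact integral_smul_integral_smul_swap f.integrable_fn g.integrable_fn
    (F := fun t s => h (t * s)) (by fun_prop)

/-- A class function is central in `L¹(G)`. -/
theorem mk_mem_ZL1 {f : G → ℂ} (hf : Integrable f (probHaar G))
    (hc : ∀ x y, f (x * y * x⁻¹) = f y) : L1.mk f hf ∈ ZL1 G := by
  rw [mem_ZL1_iff]
  intro g
  refine L1.ext_pair fun h => ?_
  rw [pair_mul', pair_mul]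
  refine integral_congr_ae (Eventually.of_forall fun s => ?_)
  simp only
  congr 1
  have key : ∀ k : G → ℂ, ∫ t, (L1.mk f hf).fn t * k t ∂(probHaar G) =
      ∫ t, f t * k t ∂(probHaar G) := fun k => by
    refine integral_congr_ae ?_
    filter_upwards [L1.fn_mk hf] with t ht
    rw [ht]
  rw [key fun t => h (t * s), key fun t => h (s * t),
    ← integral_mul_left_eq_self (fun t => f t * h (t * s)) s,
    ← integral_mul_right_eq_self (fun t => f (s * t) * h (s * t * s)) s⁻¹]
  simp only [← mul_assoc, hc, inv_mul_cancel_right]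

/-- Central elements of `L¹(G)` are invariant under conjugation. -/
theorem pair_conj_of_mem_ZL1 {a : L1 G} (ha : a ∈ ZL1 G) (h : C(G, ℂ)) (x : G) :
    ∫ y, a.fn y * h (x * y * x⁻¹) ∂(probHaar G) = pair h a := by
  -- `k` vanishes because its integral against every integrable function does
  have main : ∀ h : C(G, ℂ), ∀ s, ∫ t, a.fn t * h (t * s) ∂(probHaar G) -
      ∫ t, a.fn t * h (s * t) ∂(probHaar G) = 0 := by
    intro h
    let k : C(G, ℂ) := ⟨fun s => ∫ t, a.fn t * h (t * s) ∂(probHaar G) -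
      ∫ t, a.fn t * h (s * t) ∂(probHaar G),
      (continuous_integral_smul a.integrable_fn (F := fun s t => h (t * s)) (by fun_prop)).sub
      (continuous_integral_smul a.integrable_fn (F := fun s t => h (s * t)) (by fun_prop))⟩
    have hk : ∀ g : L1 G, pair k g = 0 := by
      intro g
      have h1 := pair_mul' h a g
      rw [(mem_ZL1_iff G a).1 ha g, pair_mul] at h1
      have c1 : Integrable (fun s => g.fn s * ∫ t, a.fn t * h (t * s) ∂(probHaar G))
          (probHaar G) := integrable_smul_continuous g.integrable_fn
        (continuous_integral_smul a.integrable_fn (F := fun s t => h (t * s)) (by fun_prop))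
      have c2 : Integrable (fun s => g.fn s * ∫ t, a.fn t * h (s * t) ∂(probHaar G))
          (probHaar G) := integrable_smul_continuous g.integrable_fn
        (continuous_integral_smul a.integrable_fn (F := fun s t => h (s * t)) (by fun_prop))
      rw [pair_apply]
      simp only [k, ContinuousMap.coe_mk, mul_sub]
      rw [integral_sub c1 c2, h1, sub_self]
    let k' : C(G, ℂ) := ⟨fun s => conj (k s), Complex.continuous_conj.comp k.continuous⟩
    have h2 := hk (L1.mk k' (integrable_probHaar k'))
    rw [pair_mk] at h2
    have h3 : ∫ t, ‖k t‖ ^ 2 ∂(probHaar G) = 0 := by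
      have : ∫ t, k' t * k t ∂(probHaar G) = ((∫ t, ‖k t‖ ^ 2 ∂(probHaar G) : ℝ) : ℂ) := by
        rw [← integral_complex_ofReal]
        refine integral_congr_ae (Eventually.of_forall fun t => ?_)
        simp only [k', ContinuousMap.coe_mk]
        rw [← Complex.normSq_eq_conj_mul_self, Complex.normSq_eq_norm_sq]
      rw [this] at h2
      exact_mod_cast h2
    intro s
    exact eq_zero_of_integral_norm_sq_eq_zero k.continuous h3 s
  have h1 := main (⟨fun y => h (y * x⁻¹), by fun_prop⟩) x
  simp only [ContinuousMap.coe_mk, mul_inv_cancel_right] at h1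
  rw [pair_apply, ← sub_eq_zero.1 h1]

end Pairing

/-! ### Divisibility by two -/

section CommutativeGroupAlgebra

variable {Q : Type u} [CommGroup Q] [TopologicalSpace Q] [IsTopologicalGroup Q] [CompactSpace Q]
  [MeasurableSpace Q] [BorelSpace Q]

theorem L1.mul_comm' (f g : L1 Q) : f * g = g * f := by
  refine L1.ext_pair fun h => ?_
  rw [pair_mul', pair_mul]
  simp only [mul_comm]

/-- The convolution of two continuous functions, as a continuous function. -/
noncomputable def contConv (f g : C(Q, ℂ)) : C(Q, ℂ) :=
  ⟨fun s => ∫ t, f t * g (t⁻¹ * s) ∂(probHaar Q),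
    continuous_integral_smul (integrable_probHaar f) (F := fun s t => g (t⁻¹ * s)) (by fun_prop)⟩

theorem contConv_apply (f g : C(Q, ℂ)) (s : Q) :
    contConv f g s = ∫ t, f t * g (t⁻¹ * s) ∂(probHaar Q) := rfl

theorem mk_mul_mk (f g : C(Q, ℂ)) :
    L1.mk f (integrable_probHaar f) * L1.mk g (integrable_probHaar g) =
      L1.mk (contConv f g) (integrable_probHaar _) := by
  refine L1.ext_pair fun h => ?_
  have h1 : ∀ t, ∫ s, (L1.mk g (integrable_probHaar g)).fn s * h (t * s) ∂(probHaar Q) =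
      ∫ s, g (t⁻¹ * s) * h s ∂(probHaar Q) := by
    intro t
    rw [← integral_mul_left_eq_self (fun s => g (t⁻¹ * s) * h s) t]
    refine integral_congr_ae ?_
    filter_upwards [L1.fn_mk (integrable_probHaar g)] with s hs
    simp [hs]
  have h2 : ∀ k : Q → ℂ, ∫ t, (L1.mk f (integrable_probHaar f)).fn t * k t ∂(probHaar Q) =
      ∫ t, f t * k t ∂(probHaar Q) := fun k => by
    refine integral_congr_ae ?_
    filter_upwards [L1.fn_mk (integrable_probHaar f)] with t ht
    rw [ht]
  rw [pair_mul]
  simp only [h1]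
  rw [h2, pair_mk]
  refine (integral_smul_integral_swap (integrable_probHaar f)
    (F := fun t s => g (t⁻¹ * s) * h s) (by fun_prop)).trans ?_
  refine integral_congr_ae (Eventually.of_forall fun s => ?_)
  simp only [contConv_apply, smul_eq_mul, ← mul_assoc]
  rw [integral_mul_const]

theorem norm_contConv_le (f g : C(Q, ℂ)) : ‖contConv f g‖ ≤ ‖f‖ * ‖g‖ := by
  rw [ContinuousMap.norm_le _ (by positivity)]
  intro s
  have := norm_integral_le_of_norm_le_const (μ := probHaar Q)
    (f := fun t => f t * g (t⁻¹ * s)) (C := ‖f‖ * ‖g‖) (Eventually.of_forall fun t => by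
      rw [norm_mul]
      exact mul_le_mul (f.norm_coe_le_norm _) (g.norm_coe_le_norm _) (norm_nonneg _)
        (norm_nonneg _))
  rw [contConv_apply]
  simpa using this

/-- Convolution by a real symmetric function is a symmetric operator on `L²`. -/
theorem inner_contConv {f : C(Q, ℂ)} (hreal : ∀ t, conj (f t) = f t)
    (hsymm : ∀ t, f t⁻¹ = f t) (g h : C(Q, ℂ)) :
    inner ℂ (ContinuousMap.toLp 2 (probHaar Q) ℂ (contConv f g))
        (ContinuousMap.toLp 2 (probHaar Q) ℂ h) =
      inner ℂ (ContinuousMap.toLp 2 (probHaar Q) ℂ g)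
        (ContinuousMap.toLp 2 (probHaar Q) ℂ (contConv f h)) := by
  rw [ContinuousMap.inner_toLp, ContinuousMap.inner_toLp]
  have h1 : ∀ s, h s * conj (contConv f g s) =
      ∫ t, f t • (h s * conj (g (t⁻¹ * s))) ∂(probHaar Q) := by
    intro s
    rw [contConv_apply, ← integral_conj, ← integral_const_mul]
    simp only [map_mul, hreal, smul_eq_mul]
    simp only [mul_left_comm]
  have h2 : ∀ s, contConv f h s * conj (g s) =
      ∫ t, f t • (h (t⁻¹ * s) * conj (g s)) ∂(probHaar Q) := by
    intro s
    rw [contConv_apply, ← integral_mul_const]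
    simp only [smul_eq_mul, mul_assoc]
  simp only [h1, h2]
  rw [← integral_smul_integral_swap (integrable_probHaar f)
      (F := fun t s => h s * conj (g (t⁻¹ * s))) (by fun_prop),
    ← integral_smul_integral_swap (integrable_probHaar f)
      (F := fun t s => h (t⁻¹ * s) * conj (g s)) (by fun_prop),
    ← integral_inv_eq_self]
  refine integral_congr_ae (Eventually.of_forall fun t => ?_)
  simp only [hsymm, inv_inv]
  congr 1
  rw [← integral_mul_left_eq_self _ t⁻¹]
  simp

theorem norm_toLp_sq_le (g : C(Q, ℂ)) :
    ‖ContinuousMap.toLp 2 (probHaar Q) ℂ g‖ ^ 2 ≤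
      ‖g‖ * ‖L1.mk g (integrable_probHaar g)‖ := by
  have h1 : ‖ContinuousMap.toLp 2 (probHaar Q) ℂ g‖ ^ 2 = ∫ t, ‖g t‖ ^ 2 ∂(probHaar Q) := by
    have h := inner_self_eq_norm_sq_to_K (𝕜 := ℂ) (ContinuousMap.toLp 2 (probHaar Q) ℂ g)
    rw [ContinuousMap.inner_toLp] at h
    have h2 : ∫ t, g t * conj (g t) ∂(probHaar Q) = ((∫ t, ‖g t‖ ^ 2 ∂(probHaar Q) : ℝ) : ℂ) := by
      rw [← integral_complex_ofReal]
      refine integral_congr_ae (Eventually.of_forall fun t => ?_)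
      simp only [Complex.mul_conj, Complex.normSq_eq_norm_sq]
    rw [h2] at h
    exact Complex.ofReal_injective (by push_cast; exact h.symm)
  rw [h1, L1.norm_mk, ← integral_const_mul]
  refine integral_mono (integrable_real_of_continuous (g.continuous.norm.pow 2))
    ((integrable_real_of_continuous g.continuous.norm).const_mul _) fun t => ?_
  simp only [sq]
  gcongr
  exact g.norm_coe_le_norm t

/-- The convolution powers `f, f * f, …` of a nonzero real symmetric function decay at most
geometrically in `L¹`: their `L²` norms form a log-convex sequence of positive numbers. -/
theorem exists_geometric_lower_bound {f : C(Q, ℂ)} (hreal : ∀ t, conj (f t) = f t)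
    (hsymm : ∀ t, f t⁻¹ = f t) (hf : f ≠ 0) :
    ∃ c r : ℝ, 0 < c ∧ 0 < r ∧ ∀ n : ℕ,
      c * r ^ n ≤ ‖L1.mk ((contConv f)^[n] f) (integrable_probHaar _)‖ := by
  set g : ℕ → C(Q, ℂ) := fun n => (contConv f)^[n] f with hg
  have hsucc : ∀ n, g (n + 1) = contConv f (g n) := fun n =>
    Function.iterate_succ_apply' _ _ _
  set v : ℕ → Lp ℂ 2 (probHaar Q) := fun n => ContinuousMap.toLp 2 (probHaar Q) ℂ (g n) with hv
  have hinj : ∀ k : C(Q, ℂ), k ≠ 0 → 0 < ‖ContinuousMap.toLp 2 (probHaar Q) ℂ k‖ := by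
    intro k hk
    rw [norm_pos_iff]
    intro h0
    exact hk (ContinuousMap.toLp_injective (p := 2) (𝕜 := ℂ) (probHaar Q) (by rw [h0, map_zero]))
  have hconvex : ∀ n, ‖v (n + 1)‖ ^ 2 ≤ ‖v n‖ * ‖v (n + 2)‖ := by
    intro n
    have h1 : inner ℂ (v (n + 1)) (v (n + 1)) = inner ℂ (v n) (v (n + 2)) := by
      have := inner_contConv hreal hsymm (g n) (g (n + 1))
      simp only [hv]
      rw [hsucc (n + 1), ← this, ← hsucc]
    have h2 := norm_inner_le_norm (𝕜 := ℂ) (v n) (v (n + 2))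
    rw [← h1, inner_self_eq_norm_sq_to_K] at h2
    simpa using h2
  have h0 : 0 < ‖v 0‖ := hinj _ hf
  have h1 : 0 < ‖v 1‖ := by
    refine hinj _ fun h => hf ?_
    have h2 : g 1 1 = 0 := by rw [h]; rfl
    rw [hsucc, contConv_apply] at h2
    have h3 : ∫ t, f t * g 0 (t⁻¹ * 1) ∂(probHaar Q) =
        ((∫ t, ‖f t‖ ^ 2 ∂(probHaar Q) : ℝ) : ℂ) := by
      rw [← integral_complex_ofReal]
      refine integral_congr_ae (Eventually.of_forall fun t => ?_)
      simp only [mul_one, hg, Function.iterate_zero, id, hsymm]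
      rw [← Complex.normSq_eq_norm_sq, ← Complex.mul_conj, hreal]
    rw [h3] at h2
    ext t
    exact eq_zero_of_integral_norm_sq_eq_zero f.continuous (by exact_mod_cast h2) t
  set r := ‖v 1‖ / ‖v 0‖ with hr
  have hrpos : 0 < r := by positivity
  have hstep : ∀ n, 0 < ‖v n‖ ∧ r * ‖v n‖ ≤ ‖v (n + 1)‖ := by
    intro n
    induction n with
    | zero => exact ⟨h0, by rw [hr, div_mul_cancel₀ _ h0.ne']⟩
    | succ n ih =>
      obtain ⟨ihp, ihr⟩ := ih
      have hp : 0 < ‖v (n + 1)‖ := lt_of_lt_of_le (by positivity) ihr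
      refine ⟨hp, ?_⟩
      have := hconvex n
      have h5 : ‖v n‖ * (r * ‖v (n + 1)‖) ≤ ‖v n‖ * ‖v (n + 2)‖ := by nlinarith
      exact le_of_mul_le_mul_left h5 ihp
  have hgeo : ∀ n, ‖v 0‖ * r ^ n ≤ ‖v n‖ := by
    intro n
    induction n with
    | zero => simp
    | succ n ih =>
      refine le_trans ?_ (hstep n).2
      rw [pow_succ]
      nlinarith
  have hfpos : 0 < ‖f‖ := norm_pos_iff.2 hf
  have hsup : ∀ n, ‖g n‖ ≤ ‖f‖ ^ (n + 1) := by
    intro n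
    induction n with
    | zero => simp [hg]
    | succ n ih =>
      rw [hsucc, pow_succ']
      exact (norm_contConv_le _ _).trans (by gcongr)
  refine ⟨‖v 0‖ ^ 2 / ‖f‖, r ^ 2 / ‖f‖, by positivity, by positivity, fun n => ?_⟩
  have h6 : (‖v 0‖ * r ^ n) ^ 2 ≤ ‖f‖ ^ (n + 1) * ‖L1.mk (g n) (integrable_probHaar _)‖ :=
    calc _ ≤ ‖v n‖ ^ 2 := by gcongr; exact hgeo n
      _ ≤ _ := norm_toLp_sq_le (g n)
      _ ≤ _ := by gcongr; exact hsup n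
  have h7 : ‖v 0‖ ^ 2 / ‖f‖ * (r ^ 2 / ‖f‖) ^ n = (‖v 0‖ * r ^ n) ^ 2 / ‖f‖ ^ (n + 1) := by
    rw [div_pow, mul_pow, pow_succ ‖f‖, ← pow_mul, ← pow_mul, mul_comm n 2]
    field_simp
  rw [h7, div_le_iff₀' (by positivity)]
  exact h6

/-- The unitization of the group algebra of a commutative group. -/
abbrev L1Unit (Q : Type u) [CommGroup Q] [TopologicalSpace Q] [IsTopologicalGroup Q]
    [CompactSpace Q] [MeasurableSpace Q] [BorelSpace Q] : Type u :=
  WithLp 1 (Unitization ℂ (L1 Q))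

noncomputable instance : NormedCommRing (L1Unit Q) :=
  { (inferInstance : NormedRing (L1Unit Q)) with
    mul_comm := fun x y => by
      refine WithLp.ofLp_injective 1 ?_
      rw [WithLp.unitization_mul, WithLp.unitization_mul]
      refine Unitization.ext ?_ ?_
      · simp [mul_comm]
      · simp only [Unitization.snd_mul, L1.mul_comm' x.ofLp.snd]
        abel }

/-- The inclusion of the group algebra in its unitization. -/
noncomputable def toUnit (f : L1 Q) : L1Unit Q := WithLp.toLp 1 (f : Unitization ℂ (L1 Q))

theorem toUnit_mul (f g : L1 Q) : toUnit (f * g) = toUnit f * toUnit g := by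
  refine WithLp.ofLp_injective 1 ?_
  rw [WithLp.unitization_mul]
  simp [toUnit]

theorem norm_toUnit (f : L1 Q) : ‖toUnit f‖ = ‖f‖ := WithLp.unitization_norm_inr f

/-- A continuous function which is real, symmetric and nonzero is not annihilated by some
multiplicative functional, because its spectral radius in `L¹` is positive. -/
theorem exists_multiplicative_functional {f : C(Q, ℂ)} (hreal : ∀ t, conj (f t) = f t)
    (hsymm : ∀ t, f t⁻¹ = f t) (hf : f ≠ 0) :
    ∃ ψ : L1 Q →L[ℂ] ℂ, (∀ g h, ψ (g * h) = ψ g * ψ h) ∧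
      ψ (L1.mk f (integrable_probHaar f)) ≠ 0 := by
  obtain ⟨c, r, hc, hr, hcr⟩ := exists_geometric_lower_bound hreal hsymm hf
  set F := L1.mk f (integrable_probHaar f) with hF
  have hpow : ∀ n : ℕ, toUnit F ^ (n + 1) =
      toUnit (L1.mk ((contConv f)^[n] f) (integrable_probHaar _)) := by
    intro n
    induction n with
    | zero => simp [hF]
    | succ n ih =>
      rw [pow_succ', ih, ← toUnit_mul, hF, mk_mul_mk]
      simp only [Function.iterate_succ_apply']
  have hex : ∃ φ : WeakDual.characterSpace ℂ (L1Unit Q), φ (toUnit F) ≠ 0 := by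
    by_contra! hall
    have hspec : spectralRadius ℂ (toUnit F) = 0 := by
      simp only [spectralRadius]
      refine le_antisymm (iSup₂_le fun z hz => ?_) bot_le
      obtain ⟨φ, hφ⟩ := WeakDual.CharacterSpace.mem_spectrum_iff_exists.1 hz
      rw [← hφ, hall φ]
      simp
    have hlim := spectrum.pow_norm_pow_one_div_tendsto_nhds_spectralRadius (toUnit F)
    rw [hspec] at hlim
    have hev := hlim.eventually (gt_mem_nhds (show (0 : ENNReal) < ENNReal.ofReal (r / 2) by
      simpa using hr))
    have hhalf : ∀ᶠ n : ℕ in atTop, (1 / 2 : ℝ) ^ n < c / r :=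
      (tendsto_pow_atTop_nhds_zero_of_lt_one (by norm_num) (by norm_num)).eventually
        (gt_mem_nhds (by positivity))
    obtain ⟨n, ⟨hn1, hn2⟩, hn3⟩ := ((hev.and hhalf).and (eventually_gt_atTop 0)).exists
    obtain ⟨m, rfl⟩ : ∃ m, n = m + 1 := ⟨n - 1, by omega⟩
    rw [ENNReal.ofReal_lt_ofReal_iff (by positivity)] at hn1
    have h2 : ‖toUnit F ^ (m + 1)‖ < (r / 2) ^ (m + 1) := by
      have h3 := pow_lt_pow_left₀ hn1 (by positivity) (Nat.succ_ne_zero m)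
      rw [← Real.rpow_natCast, ← Real.rpow_mul (norm_nonneg _)] at h3
      have h4 : (1 / ((m + 1 : ℕ) : ℝ)) * ((m.succ : ℕ) : ℝ) = 1 := by
        rw [Nat.succ_eq_add_one]
        have : ((m + 1 : ℕ) : ℝ) ≠ 0 := by positivity
        field_simp
      rwa [h4, Real.rpow_one] at h3
    rw [hpow, norm_toUnit] at h2
    have h5 := (hcr m).trans_lt h2
    have h6 : (r / 2) ^ (m + 1) = r ^ (m + 1) * (1 / 2 : ℝ) ^ (m + 1) := by
      rw [← mul_pow]; ring_nf
    have h7 : r ^ (m + 1) * (1 / 2 : ℝ) ^ (m + 1) < r ^ (m + 1) * (c / r) := by gcongr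
    have h8 : r ^ (m + 1) * (c / r) = c * r ^ m := by
      rw [pow_succ]; field_simp
    linarith
  obtain ⟨φ, hφ⟩ := hex
  refine ⟨LinearMap.mkContinuous
    { toFun := fun g => φ (toUnit g)
      map_add' := fun g h => by
        rw [← map_add]
        congr 1
        exact WithLp.ofLp_injective 1 (by simp [toUnit])
      map_smul' := fun a g => by
        rw [RingHom.id_apply, ← map_smul]
        congr 1
        exact WithLp.ofLp_injective 1 (by simp [toUnit]) }
    ‖WeakDual.toStrongDual (φ : WeakDual ℂ (L1Unit Q))‖
    (fun g => by
      rw [← norm_toUnit g]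
      exact (WeakDual.toStrongDual (φ : WeakDual ℂ (L1Unit Q))).le_opNorm (toUnit g)),
    fun g h => ?_, hφ⟩
  change φ (toUnit (g * h)) = φ (toUnit g) * φ (toUnit h)
  rw [toUnit_mul, map_mul]

end CommutativeGroupAlgebra

/-- A nontrivial compact group of exponent two has a nontrivial real character. -/
theorem exists_character_of_exponent_two {Q : Type u} [CommGroup Q] [TopologicalSpace Q]
    [IsTopologicalGroup Q] [CompactSpace Q] [T2Space Q] (hexp : ∀ q : Q, q * q = 1)
    [Nontrivial Q] :
    ∃ χ : Q →ₜ* Circle, (∀ q, conj (χ q : ℂ) = χ q) ∧ ∃ q, χ q ≠ 1 := by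
  let : MeasurableSpace Q := borel Q
  have : BorelSpace Q := ⟨rfl⟩
  obtain ⟨q, hq⟩ := exists_ne (1 : Q)
  obtain ⟨k, hk1, hkq, -⟩ := exists_continuous_zero_one_of_isClosed
    (isClosed_singleton (x := (1 : Q))) (isClosed_singleton (x := q)) (by simpa using hq.symm)
  let f : C(Q, ℂ) := ⟨fun t => ((k t - ∫ s, k s ∂(probHaar Q) : ℝ) : ℂ), by fun_prop⟩
  have hf0 : f ≠ 0 := by
    intro h
    have h1 : f q = f 1 := by rw [h]; rfl
    have h2 : k 1 = 0 := hk1 rfl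
    have h3 : k q = 1 := hkq rfl
    simp [f, h2, h3] at h1
  have hreal : ∀ t, conj (f t) = f t := fun t => Complex.conj_ofReal _
  have hint : ∫ t, f t ∂(probHaar Q) = 0 := by
    simp only [f, ContinuousMap.coe_mk]
    rw [integral_complex_ofReal, integral_sub (integrable_real_of_continuous k.continuous)
      (integrable_const _)]
    simp
  have hsymm : ∀ t, f t⁻¹ = f t := fun t => by rw [inv_eq_of_mul_eq_one_left (hexp t)]
  obtain ⟨ψ, hψ, hψf⟩ := exists_multiplicative_functional hreal hsymm hf0
  set F := L1.mk f (integrable_probHaar f) with hF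
  let χ₀ : Q → ℂ := fun t => ψ (translate t F) / ψ F
  have hmul : ∀ s t, χ₀ (s * t) = χ₀ s * χ₀ t := by
    intro s t
    have h1 : translate s F * translate t F = translate (s * t) F * F := by
      have e1 : translate s F * translate t F = translate s (F * translate t F) :=
        (translate_conv s F (translate t F)).symm
      have e2 : translate t F * F = translate t (F * F) := (translate_conv t F F).symm
      have e3 : translate (s * t) F * F = translate (s * t) (F * F) :=
        (translate_conv (s * t) F F).symm
      rw [e1, L1.mul_comm' F, e2, translate_translate, e3]
    have h2 := congrArg ψ h1
    rw [hψ, hψ] at h2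
    simp only [χ₀]
    rw [div_mul_div_comm, h2, mul_div_mul_right _ _ hψf]
  have hone : χ₀ 1 = 1 := by
    simp only [χ₀, translate_one, div_self hψf]
  have hpm : ∀ t, χ₀ t = 1 ∨ χ₀ t = -1 := fun t => by
    rw [← mul_self_eq_one_iff, ← hmul, hexp, hone]
  have hcont : Continuous χ₀ := (ψ.continuous.comp (continuous_translate F)).div_const _
  have hcirc : ∀ t, χ₀ t ∈ Submonoid.unitSphere ℂ := fun t => by
    rcases hpm t with h | h <;> simp [h, Submonoid.unitSphere]
  refine ⟨{ toFun := fun t => ⟨χ₀ t, hcirc t⟩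
            map_one' := Subtype.ext hone
            map_mul' := fun s t => Subtype.ext (hmul s t)
            continuous_toFun := hcont.subtype_mk _ }, fun t => ?_, ?_⟩
  · change conj (χ₀ t) = χ₀ t
    rcases hpm t with h | h <;> simp [h]
  · by_contra! hall
    have hone' : ∀ t, ψ (translate t F) = ψ F := fun t => by
      have h1 : χ₀ t = 1 := congrArg Subtype.val (hall t)
      exact (div_eq_one_iff_eq hψf).1 h1
    -- the functional would be a multiple of the integral, which vanishes on `F`
    have h1 : ψ (F * F) = 0 := by
      rw [L1.mul_def, ← ψ.integral_comp_comm (integrable_conv F F)]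
      simp only [map_smul, hone', smul_eq_mul]
      rw [integral_mul_const, integral_congr_ae (L1.fn_mk (integrable_probHaar f)), hint, zero_mul]
    rw [hψ] at h1
    exact hψf (mul_self_eq_zero.1 h1)

/-- If the only real character of `T` is trivial then every element of `T` is a square. -/
theorem surjective_mul_self {T : Type u} [CommGroup T] [TopologicalSpace T]
    [IsTopologicalGroup T] [CompactSpace T] [T2Space T] (hT : OnlyTrivialRealCharacter T) :
    Function.Surjective fun t : T => t * t := by
  by_contra hns
  let N : Subgroup T := (powMonoidHom 2 : T →* T).range
  have hN : ∀ t, t ∈ N ↔ ∃ s, s * s = t := fun t => by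
    simp only [N, MonoidHom.mem_range, powMonoidHom_apply, sq]
  have : IsClosed (N : Set T) := by
    have : (N : Set T) = Set.range fun t : T => t * t := by
      ext t
      exact hN t
    rw [this]
    exact (isCompact_range (by fun_prop)).isClosed
  simp only [Function.Surjective, not_forall] at hns
  obtain ⟨t₀, ht₀⟩ := hns
  have : Nontrivial (T ⧸ N) := ⟨⟨t₀, 1, fun h => ht₀ ((hN t₀).1
    ((QuotientGroup.eq_one_iff t₀).1 h))⟩⟩
  have hexp : ∀ q : T ⧸ N, q * q = 1 := by
    intro q
    obtain ⟨t, rfl⟩ := QuotientGroup.mk_surjective q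
    rw [← QuotientGroup.mk_mul]
    exact (QuotientGroup.eq_one_iff _).2 ((hN _).2 ⟨t, rfl⟩)
  obtain ⟨χ, hχ, q, hq⟩ := exists_character_of_exponent_two hexp
  obtain ⟨t, rfl⟩ := QuotientGroup.mk_surjective q
  refine hq (hT (χ.comp ⟨QuotientGroup.mk' N, QuotientGroup.continuous_mk⟩) (fun t => hχ _) t)

/-! ### Central measures -/

section CentralMeasures

/-- Fubini's theorem for Radon measures; by Stone–Weierstrass it is enough to integrate
functions of the form `f(x) g(y)`. -/
theorem prodMeasure_swap {K L : Type*} [TopologicalSpace K] [CompactSpace K] [T2Space K]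
    [TopologicalSpace L] [CompactSpace L] [T2Space L] (μ : RadonMeasure K) (ν : RadonMeasure L)
    (u : C(K × L, ℂ)) :
    prodMeasure μ ν u = prodMeasure ν μ (u.comp ⟨Prod.swap, continuous_swap⟩) := by
  let P : Submodule ℂ C(K × L, ℂ) :=
    Submodule.span ℂ (Set.range fun p : C(K, ℂ) × C(L, ℂ) => p.1.prodMul p.2)
  have hprod : ∀ (f f' : C(K, ℂ)) (g g' : C(L, ℂ)),
      f.prodMul g * f'.prodMul g' = (f * f').prodMul (g * g') := by
    intro f f' g g'
    ext p
    simp [mul_mul_mul_comm]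
  have hmul : ∀ a ∈ P, ∀ b ∈ P, a * b ∈ P := by
    intro a ha b hb
    induction ha using Submodule.span_induction with
    | zero => rw [zero_mul]; exact P.zero_mem
    | add x y _ _ hx hy => rw [add_mul]; exact P.add_mem hx hy
    | smul c x _ hx => rw [smul_mul_assoc]; exact P.smul_mem c hx
    | mem x hx =>
      obtain ⟨⟨f, g⟩, rfl⟩ := hx
      induction hb using Submodule.span_induction with
      | zero => rw [mul_zero]; exact P.zero_mem
      | add x y _ _ hx hy => rw [mul_add]; exact P.add_mem hx hy
      | smul c x _ hx => rw [mul_smul_comm]; exact P.smul_mem c hx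
      | mem y hy =>
        obtain ⟨⟨f', g'⟩, rfl⟩ := hy
        rw [hprod]
        exact Submodule.subset_span ⟨(f * f', g * g'), rfl⟩
  have hmem : ∀ (f : C(K, ℂ)) (g : C(L, ℂ)), f.prodMul g ∈ P := fun f g =>
    Submodule.subset_span ⟨(f, g), rfl⟩
  have hconst : ∀ r : ℂ, algebraMap ℂ C(K × L, ℂ) r ∈ P := by
    intro r
    have : algebraMap ℂ C(K × L, ℂ) r = r • (1 : C(K, ℂ)).prodMul (1 : C(L, ℂ)) := by
      ext p
      simp
    rw [this]
    exact P.smul_mem r (hmem 1 1)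
  let S : StarSubalgebra ℂ C(K × L, ℂ) :=
    { carrier := P
      mul_mem' := fun ha hb => hmul _ ha _ hb
      add_mem' := P.add_mem
      algebraMap_mem' := hconst
      star_mem' := fun {a} ha => by
        change star a ∈ P
        induction ha using Submodule.span_induction with
        | zero => rw [star_zero]; exact P.zero_mem
        | add x y _ _ hx hy => rw [star_add]; exact P.add_mem hx hy
        | smul c x _ hx => rw [star_smul]; exact P.smul_mem _ hx
        | mem x hx =>
          obtain ⟨⟨f, g⟩, rfl⟩ := hx
          have : star (f.prodMul g) = (star f).prodMul (star g) := by
            ext p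
            simp
          simp only [this]
          exact hmem _ _ }
  have hsep : S.SeparatesPoints := by
    intro p q hpq
    rcases Prod.ext_iff.not.1 hpq |> not_and_or.1 with h | h
    · obtain ⟨k, hk1, hk2, -⟩ := exists_continuous_zero_one_of_isClosed
        (isClosed_singleton (x := p.1)) (isClosed_singleton (x := q.1)) (by simpa using h)
      let k' : C(K, ℂ) := ⟨fun x => (k x : ℂ), by fun_prop⟩
      refine ⟨_, ⟨k'.prodMul 1, hmem _ _, rfl⟩, ?_⟩
      have e1 : k p.1 = 0 := hk1 rfl
      have e2 : k q.1 = 1 := hk2 rfl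
      simp [k', e1, e2]
    · obtain ⟨k, hk1, hk2, -⟩ := exists_continuous_zero_one_of_isClosed
        (isClosed_singleton (x := p.2)) (isClosed_singleton (x := q.2)) (by simpa using h)
      let k' : C(L, ℂ) := ⟨fun x => (k x : ℂ), by fun_prop⟩
      refine ⟨_, ⟨(1 : C(K, ℂ)).prodMul k', hmem _ _, rfl⟩, ?_⟩
      have e1 : k p.2 = 0 := hk1 rfl
      have e2 : k q.2 = 1 := hk2 rfl
      simp [k', e1, e2]
  have hdense : u ∈ closure (P : Set C(K × L, ℂ)) := by
    have h := ContinuousMap.starSubalgebra_topologicalClosure_eq_top_of_separatesPoints S hsep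
    have h2 : u ∈ S.topologicalClosure := by rw [h]; trivial
    exact h2
  let Φ : C(K × L, ℂ) →L[ℂ] ℂ := prodMeasure μ ν
  let Ψ : C(K × L, ℂ) →L[ℂ] ℂ :=
    pushforward (⟨Prod.swap, continuous_swap⟩ : C(L × K, K × L)) (prodMeasure ν μ)
  have hclosed : IsClosed {v : C(K × L, ℂ) | Φ v = Ψ v} :=
    isClosed_eq Φ.continuous Ψ.continuous
  have hsub : (P : Set C(K × L, ℂ)) ⊆ {v | Φ v = Ψ v} := by
    intro v hv
    change Φ v = Ψ v
    induction hv using Submodule.span_induction with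
    | zero => rw [map_zero, map_zero]
    | add x y _ _ hx hy => rw [map_add, map_add, hx, hy]
    | smul c x _ hx => rw [map_smul, map_smul, hx]
    | mem x hx =>
      obtain ⟨⟨f, g⟩, rfl⟩ := hx
      change μ ⟨fun x => ν ⟨fun y => f x * g y, _⟩, _⟩ = ν ⟨fun y => μ ⟨fun x => f x * g y, _⟩, _⟩
      have e1 : ∀ x, ν ⟨fun y => f x * g y, by fun_prop⟩ = f x * ν g := fun x => by
        have : (⟨fun y => f x * g y, by fun_prop⟩ : C(L, ℂ)) = f x • g := rfl
        rw [this, map_smul, smul_eq_mul]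
      have e2 : ∀ y, μ ⟨fun x => f x * g y, by fun_prop⟩ = g y * μ f := fun y => by
        have : (⟨fun x => f x * g y, by fun_prop⟩ : C(K, ℂ)) = g y • f := by
          ext x
          simp [mul_comm]
        rw [this, map_smul, smul_eq_mul]
      have e3 : (⟨fun x => ν ⟨fun y => f x * g y, by fun_prop⟩, by
          simp only [e1]; fun_prop⟩ : C(K, ℂ)) = ν g • f := by
        ext x
        simp [e1, mul_comm]
      have e4 : (⟨fun y => μ ⟨fun x => f x * g y, by fun_prop⟩, by
          simp only [e2]; fun_prop⟩ : C(L, ℂ)) = μ f • g := by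
        ext y
        simp [e2, mul_comm]
      rw [e3, e4, map_smul, map_smul, smul_eq_mul, smul_eq_mul, mul_comm]
  exact (hclosed.closure_subset_iff.2 hsub) hdense

/-- A measure invariant under conjugation is central. -/
theorem isCentral_of_conj_invariant {H : Type*} [Group H] [TopologicalSpace H]
    [IsTopologicalGroup H] [CompactSpace H] [T2Space H] {μ : RadonMeasure H}
    (hμ : ∀ (x : H) (u : C(H, ℂ)), μ (u.comp ⟨fun y => x * y * x⁻¹, by fun_prop⟩) = μ u) :
    IsCentral μ := by
  intro ν
  ext u
  have h1 : convMeasure μ ν u = prodMeasure ν μ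
      ((u.comp ⟨fun p : H × H => p.1 * p.2, continuous_mul⟩).comp
        ⟨Prod.swap, continuous_swap⟩) := prodMeasure_swap μ ν _
  rw [h1]
  change ν ⟨fun y => μ ⟨fun x => u (x * y), _⟩, _⟩ = ν ⟨fun y => μ ⟨fun x => u (y * x), _⟩, _⟩
  congr 1
  ext y
  have := hμ y ⟨fun x => u (x * y), by fun_prop⟩
  change μ ⟨fun x => u (x * y), by fun_prop⟩ = μ ⟨fun x => u (y * x), by fun_prop⟩
  rw [← this]
  congr 1
  ext x
  simp

variable {T : Type u} [CommGroup T]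

theorem dih_conj (g : Dih T) (t : T) :
    g * (⟨t, 1⟩ : Dih T) * g⁻¹ = ⟨t ^ (g.right : ℤ), 1⟩ := by
  refine SemidirectProduct.ext ?_ ?_
  · change g.left * t ^ (g.right : ℤ) * ((g.left⁻¹ ^ ((g.right⁻¹ : ℤˣ) : ℤ)) ^
      ((g.right * 1 : ℤˣ) : ℤ)) = t ^ (g.right : ℤ)
    rw [← zpow_mul, ← Units.val_mul, mul_one, inv_mul_cancel, Units.val_one, zpow_one,
      mul_right_comm, mul_inv_cancel, one_mul]
  · change g.right * 1 * g.right⁻¹ = 1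
    simp

variable [TopologicalSpace T]

theorem sgn_mul (x y : Dih T) : sgn T (x * y) = sgn T x * sgn T y := by
  change (((x.right * y.right : ℤˣ) : ℤ) : ℂ) = _
  rw [Units.val_mul, Int.cast_mul]
  rfl

theorem sgn_sq (x : Dih T) : sgn T x * sgn T x = 1 := by
  change (((x.right : ℤˣ) : ℤ) : ℂ) * (((x.right : ℤˣ) : ℤ) : ℂ) = 1
  rw [← Int.cast_mul, ← Units.val_mul, Int.units_mul_self]
  simp

theorem sgn_inv (x : Dih T) : sgn T x⁻¹ = sgn T x := by
  have h : sgn T x⁻¹ * sgn T x = 1 := by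
    rw [← sgn_mul, inv_mul_cancel]
    simp [sgn]
  calc sgn T x⁻¹ = sgn T x⁻¹ * (sgn T x * sgn T x) := by rw [sgn_sq, mul_one]
    _ = sgn T x := by rw [← mul_assoc, h, one_mul]

theorem sgn_conj (x y : Dih T) : sgn T (x * y * x⁻¹) = sgn T y := by
  rw [sgn_mul, sgn_mul, sgn_inv, mul_right_comm, sgn_sq, one_mul]

theorem integral_conj_eq_self {G E : Type*} [Group G] [TopologicalSpace G] [IsTopologicalGroup G]
    [CompactSpace G] [MeasurableSpace G] [BorelSpace G] [NormedAddCommGroup E] [NormedSpace ℝ E]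
    (f : G → E) (g : G) :
    ∫ x, f (g * x * g⁻¹) ∂(probHaar G) = ∫ x, f x ∂(probHaar G) := by
  rw [integral_mul_left_eq_self (fun x => f (x * g⁻¹)) g, integral_mul_right_eq_self f g⁻¹]

variable [IsTopologicalGroup T] [CompactSpace T] [T2Space T]

theorem diagonalMeasure_apply [MeasurableSpace T] [BorelSpace T] (u : C(Dih T × Dih T, ℂ)) :
    diagonalMeasure T u =
      ∫ x, ∫ y, centralDensity T (x, y) * u (x, y) ∂(probHaar (Dih T)) ∂(probHaar (Dih T)) +
      ∫ t : T, u (⟨t, 1⟩, ⟨t, 1⟩) ∂(probHaar T) + ∫ t : T, u (⟨t, 1⟩, ⟨t⁻¹, 1⟩) ∂(probHaar T) := by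
  have h1 : haarRadon T (u.comp (diagEmb T)) = ∫ t : T, u (⟨t, 1⟩, ⟨t, 1⟩) ∂(probHaar T) :=
    haarRadon_apply T _
  have h2 : haarRadon T (u.comp (antidiagEmb T)) = ∫ t : T, u (⟨t, 1⟩, ⟨t⁻¹, 1⟩) ∂(probHaar T) :=
    haarRadon_apply T _
  rw [← h1, ← h2]
  rfl

/-- Conjugation by a pair of group elements preserves both subgroups `D` and `A`, or interchanges
them. -/
theorem isCentral_diagonalMeasure : IsCentral (diagonalMeasure T) := by
  let : MeasurableSpace T := borel T
  have : BorelSpace T := ⟨rfl⟩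
  refine isCentral_of_conj_invariant fun g u => ?_
  obtain ⟨g, h⟩ := g
  rw [diagonalMeasure_apply, diagonalMeasure_apply, add_assoc, add_assoc]
  congr 1
  · have h1 : ∀ x y, centralDensity T (x, y) =
        centralDensity T (g * x * g⁻¹, h * y * h⁻¹) := fun x y => by
      simp only [centralDensity, ContinuousMap.coe_mk, sgn_conj]
    have h2 : ∀ x, ∫ y, centralDensity T (x, y) *
        u (g * x * g⁻¹, h * y * h⁻¹) ∂(probHaar (Dih T)) =
        ∫ y, centralDensity T (g * x * g⁻¹, y) * u (g * x * g⁻¹, y) ∂(probHaar (Dih T)) := by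
      intro x
      simp only [h1 x]
      exact integral_conj_eq_self
        (fun y => centralDensity T (g * x * g⁻¹, y) * u (g * x * g⁻¹, y)) h
    refine (integral_congr_ae (Eventually.of_forall h2)).trans ?_
    exact integral_conj_eq_self
      (fun x => ∫ y, centralDensity T (x, y) * u (x, y) ∂(probHaar (Dih T))) g
  · have e : ∀ s t : T, (u.comp ⟨fun y => (g, h) * y * (g, h)⁻¹, by fun_prop⟩)
        ((⟨s, 1⟩ : Dih T), (⟨t, 1⟩ : Dih T)) =
        u (⟨s ^ (g.right : ℤ), 1⟩, ⟨t ^ (h.right : ℤ), 1⟩) := by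
      intro s t
      rw [← dih_conj, ← dih_conj]
      rfl
    simp only [e]
    rcases Int.units_eq_one_or g.right with hg | hg <;>
      rcases Int.units_eq_one_or h.right with hh | hh <;>
      simp only [hg, hh, Units.val_one, zpow_one, Units.val_neg, zpow_neg, inv_inv]
    · rw [add_comm]
    · rw [add_comm]
      congr 1
      · rw [← integral_inv_eq_self]; simp
      · rw [← integral_inv_eq_self]; simp
    · congr 1
      · rw [← integral_inv_eq_self]; simp
      · rw [← integral_inv_eq_self]; simp

end CentralMeasures

/-! ### Integration over the two cosets of `T` -/

section HaarDecomposition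

variable {T : Type u} [CommGroup T] [TopologicalSpace T]

theorem sgn_mk_one (t : T) : sgn T ⟨t, 1⟩ = 1 := by simp [sgn]

theorem sgn_mk_neg_one (t : T) : sgn T ⟨t, -1⟩ = -1 := by simp [sgn]

theorem continuous_dih_left (a : ℤˣ) : Continuous fun t : T => (⟨t, a⟩ : Dih T) :=
  continuous_dih_mk T continuous_id continuous_const

variable [IsTopologicalGroup T] [CompactSpace T]

theorem integral_sgn : ∫ x, sgn T x ∂(probHaar (Dih T)) = 0 := by
  have h : ∫ x, sgn T ((⟨1, -1⟩ : Dih T) * x) ∂(probHaar (Dih T)) =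
      ∫ x, sgn T x ∂(probHaar (Dih T)) := integral_mul_left_eq_self _ _
  simp only [sgn_mul, sgn_mk_neg_one, neg_one_mul] at h
  rw [integral_neg] at h
  exact self_eq_neg.1 h.symm

variable [MeasurableSpace T] [BorelSpace T] {E : Type*} [NormedAddCommGroup E] [NormedSpace ℂ E]
  [CompleteSpace E]

/-- Haar measure of `T ⋊ ℤ₂` is the mean of the Haar measures of the two cosets of `T`. -/
theorem integral_dih {F : Dih T → E} (hF : Continuous F) :
    ∫ x, F x ∂(probHaar (Dih T)) =
      (2⁻¹ : ℂ) • (∫ t, F ⟨t, 1⟩ ∂(probHaar T) + ∫ t, F ⟨t, -1⟩ ∂(probHaar T)) := by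
  have h1 : ∫ x, F x ∂(probHaar (Dih T)) =
      ∫ t : T, ∫ x, F ((⟨t, 1⟩ : Dih T) * x) ∂(probHaar (Dih T)) ∂(probHaar T) := by
    simp only [integral_mul_left_eq_self]
    simp
  have hc : Continuous fun p : T × Dih T => F ((⟨p.1, 1⟩ : Dih T) * p.2) :=
    hF.comp (((continuous_dih_left 1).comp continuous_fst).mul continuous_snd)
  rw [h1, integral_integral_swap_of_continuous hc]
  set k : ℤˣ → E := fun a => ∫ t, F ⟨t, a⟩ ∂(probHaar T) with hk
  have h2 : ∀ x : Dih T, ∫ t : T, F ((⟨t, 1⟩ : Dih T) * x) ∂(probHaar T) =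
      (2⁻¹ : ℂ) • (k 1 + k (-1)) + sgn T x • ((2⁻¹ : ℂ) • (k 1 - k (-1))) := by
    intro x
    have h3 : ∫ t : T, F ((⟨t, 1⟩ : Dih T) * x) ∂(probHaar T) = k x.right := by
      change _ = ∫ t, F ⟨t, x.right⟩ ∂(probHaar T)
      rw [← integral_mul_right_eq_self (fun t => F ⟨t, x.right⟩) x.left]
      refine integral_congr_ae (Eventually.of_forall fun t => ?_)
      refine congrArg F (SemidirectProduct.ext ?_ ?_)
      · change t * x.left ^ ((1 : ℤˣ) : ℤ) = t * x.left
        simp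
      · change 1 * x.right = x.right
        simp
    rw [h3]
    change k x.right = _ + ((x.right : ℤ) : ℂ) • _
    rcases Int.units_eq_one_or x.right with h | h <;> rw [h] <;> simp <;> module
  have h4 : ∫ x, sgn T x • ((2⁻¹ : ℂ) • (k 1 - k (-1))) ∂(probHaar (Dih T)) = 0 := by
    rw [integral_smul_const, integral_sgn, zero_smul]
  simp only [h2]
  rw [integral_add (integrable_const _) ((integrable_probHaar (sgn T)).smul_const _), h4]
  simp [hk]

end HaarDecomposition

/-! ### The irreducible representations -/

section Irreps

/-- Commuting operators have a common eigenvector in every nonzero invariant subspace, by induction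
on its dimension: either all of them act as scalars, or an eigenspace of one is a smaller invariant
subspace. -/
theorem exists_common_eigenvector {V : Type*} [AddCommGroup V] [Module ℂ V]
    [FiniteDimensional ℂ V] {A : Type*} [CommMonoid A] (ρ : A →* Module.End ℂ V) :
    ∀ (n : ℕ) (W : Submodule ℂ V), Module.finrank ℂ W = n → W ≠ ⊥ →
      (∀ a, ∀ w ∈ W, ρ a w ∈ W) → ∃ v : V, v ≠ 0 ∧ ∀ a, ∃ c : ℂ, ρ a v = c • v := by
  intro n
  induction n using Nat.strong_induction_on with
  | _ n ih =>
  intro W hn hW hinv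
  by_cases hall : ∀ a, ∃ c : ℂ, ∀ w ∈ W, ρ a w = c • w
  · obtain ⟨v, hv, hv0⟩ := Submodule.exists_mem_ne_zero_of_ne_bot hW
    exact ⟨v, hv0, fun a => (hall a).imp fun c hc => hc v hv⟩
  · push Not at hall
    obtain ⟨a, ha⟩ := hall
    have : Nontrivial W := Submodule.nontrivial_iff_ne_bot.2 hW
    obtain ⟨c, hc⟩ := Module.End.exists_eigenvalue ((ρ a).restrict (hinv a))
    obtain ⟨w, hw⟩ := hc.exists_hasEigenvector
    have hw1 : ρ a w = c • (w : V) := by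
      have := congrArg Subtype.val hw.apply_eq_smul
      simpa using this
    let W' : Submodule ℂ V := W ⊓ Module.End.eigenspace (ρ a) c
    have hlt : W' < W := by
      refine lt_of_le_of_ne inf_le_left fun h => ?_
      obtain ⟨x, hx, hxc⟩ := ha c
      refine hxc (Module.End.mem_eigenspace_iff.1 ?_)
      rw [← h] at hx
      exact hx.2
    refine ih _ (hn ▸ Submodule.finrank_lt_finrank_of_lt hlt) W' rfl ?_ ?_
    · refine (Submodule.ne_bot_iff _).2 ⟨w, ⟨w.2, Module.End.mem_eigenspace_iff.2 hw1⟩, ?_⟩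
      simpa using hw.2
    · intro b x hx
      refine ⟨hinv b x hx.1, Module.End.mem_eigenspace_iff.2 ?_⟩
      rw [← Module.End.mul_apply, ← map_mul, mul_comm, map_mul, Module.End.mul_apply,
        Module.End.mem_eigenspace_iff.1 hx.2, map_smul]

/-- The representation `π` is given by the matrices `M` in some basis. -/
def UnitaryIrrep.HasMatrix {H : Type*} [Group H] [TopologicalSpace H] (π : UnitaryIrrep H)
    {ι : Type} [Fintype ι] [DecidableEq ι] (M : H → Matrix ι ι ℂ) : Prop :=
  ∃ b : Module.Basis ι ℂ (EuclideanSpace ℂ (Fin π.dim)),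
    ∀ g, LinearMap.toMatrix b b (π.rep g) = M g

namespace UnitaryIrrep

section General

variable {H : Type*} [Group H] [TopologicalSpace H] {π ρ : UnitaryIrrep H}
  {ι : Type} [Fintype ι] [DecidableEq ι] {M : H → Matrix ι ι ℂ}

theorem HasMatrix.isEquivalent (hπ : π.HasMatrix M) (hρ : ρ.HasMatrix M) : π.IsEquivalent ρ := by
  obtain ⟨b, hb⟩ := hπ
  obtain ⟨b', hb'⟩ := hρ
  refine ⟨Representation.Equiv.mk (b.equiv b' (Equiv.refl ι)) fun g => ?_⟩
  refine b.ext fun i => ?_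
  have h1 := LinearMap.toMatrix_apply b b (π.rep g)
  have h2 := LinearMap.toMatrix_apply b' b' (ρ.rep g)
  simp only [hb] at h1
  simp only [hb'] at h2
  rw [LinearMap.comp_apply, LinearMap.comp_apply, LinearEquiv.coe_coe, Module.Basis.equiv_apply,
    Equiv.refl_apply, ← b.sum_repr (π.rep g (b i)), ← b'.sum_repr (ρ.rep g (b' i)), map_sum]
  simp [← h1, ← h2]

theorem HasMatrix.normChar_apply (hπ : π.HasMatrix M) (g : H) :
    π.normChar g = (Fintype.card ι : ℂ)⁻¹ * (M g).trace := by
  obtain ⟨b, hb⟩ := hπ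
  have hdim : π.dim = Fintype.card ι := by
    rw [← Module.finrank_eq_card_basis b, finrank_euclideanSpace_fin]
  change (π.dim : ℂ)⁻¹ * LinearMap.trace ℂ _ (π.rep g) = _
  rw [LinearMap.trace_eq_matrix_trace ℂ b, hb, hdim]

theorem IsEquivalent.normChar_eq (h : π.IsEquivalent ρ) : π.normChar = ρ.normChar := by
  obtain ⟨φ⟩ := h
  have hdim : π.dim = ρ.dim := by
    have := φ.toLinearEquiv.finrank_eq
    simpa using this
  ext g
  change (π.dim : ℂ)⁻¹ * π.rep.character g = (ρ.dim : ℂ)⁻¹ * ρ.rep.character g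
  congr 1
  · rw [hdim]
  · rw [Representation.char_iso φ]

end General

variable {T : Type u} [CommGroup T]

theorem dih_mk_mul_flip (t : T) (a : ℤˣ) : (⟨t, a⟩ : Dih T) = ⟨t, 1⟩ * ⟨1, a⟩ :=
  SemidirectProduct.ext (by change t = t * 1 ^ ((1 : ℤˣ) : ℤ); simp)
    (by change a = 1 * a; simp)

theorem dih_mk_mul_flip' (t : T) : (⟨t, 1⟩ : Dih T) * ⟨1, -1⟩ = ⟨1, -1⟩ * ⟨t⁻¹, 1⟩ :=
  SemidirectProduct.ext (by
    change t * 1 ^ ((1 : ℤˣ) : ℤ) = 1 * t⁻¹ ^ ((-1 : ℤˣ) : ℤ); simp) rfl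

theorem dih_flip_mul_flip : (⟨1, -1⟩ : Dih T) * ⟨1, -1⟩ = 1 :=
  SemidirectProduct.ext (by change (1 : T) * 1 ^ ((-1 : ℤˣ) : ℤ) = 1; simp)
    (by change (-1 : ℤˣ) * -1 = 1; simp)

variable [TopologicalSpace T] (π : UnitaryIrrep (Dih T))

theorem eq_top_of_invariant {W : Submodule ℂ (EuclideanSpace ℂ (Fin π.dim))} (hW : W ≠ ⊥)
    (h1 : ∀ t, ∀ w ∈ W, π.rep ⟨t, 1⟩ w ∈ W) (h2 : ∀ w ∈ W, π.rep ⟨1, -1⟩ w ∈ W) : W = ⊤ := by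
  have hinv : ∀ g, ∀ w ∈ W, π.rep g w ∈ W := by
    rintro ⟨t, a⟩ w hw
    rw [dih_mk_mul_flip, map_mul, Module.End.mul_apply]
    refine h1 _ _ ?_
    rcases Int.units_eq_one_or a with rfl | rfl
    · exact h1 _ _ hw
    · exact h2 _ hw
  have := π.irreducible
  let S : Subrepresentation π.rep := ⟨W, fun g w hw => hinv g w hw⟩
  rcases IsSimpleOrder.eq_bot_or_eq_top S with h | h
  · exact absurd (congrArg Subrepresentation.toSubmodule h) hW
  · exact congrArg Subrepresentation.toSubmodule h

/-- The restriction of `π` to `T` contains a continuous unitary character. -/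
theorem exists_eigenvector : ∃ (χ : T →ₜ* Circle) (v : EuclideanSpace ℂ (Fin π.dim)), v ≠ 0 ∧
    ∀ t, π.rep ⟨t, 1⟩ v = (χ t : ℂ) • v := by
  let ι : T →* Dih T := SemidirectProduct.inl
  have hne : (⊤ : Submodule ℂ (EuclideanSpace ℂ (Fin π.dim))) ≠ ⊥ := by
    have := π.irreducible
    intro h
    have h2 : (⊤ : Subrepresentation π.rep) ≠ ⊥ := top_ne_bot
    exact h2 (Subrepresentation.toSubmodule_injective h)
  obtain ⟨v, hv0, hv⟩ := exists_common_eigenvector (π.rep.comp ι) _ ⊤ rfl hne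
    fun _ _ _ => Submodule.mem_top
  choose c hc using hv
  have hc' : ∀ t : T, π.rep ⟨t, 1⟩ v = c t • v := hc
  have hvn : ‖v‖ ≠ 0 := norm_ne_zero_iff.2 hv0
  have hone : c 1 = 1 := by
    have h := hc 1
    rw [map_one, Module.End.one_apply] at h
    exact (smul_left_injective ℂ hv0 (by simpa using h)).symm
  have hmul : ∀ s t, c (s * t) = c s * c t := by
    intro s t
    refine smul_left_injective ℂ hv0 ?_
    change c (s * t) • v = (c s * c t) • v
    rw [← hc, map_mul, Module.End.mul_apply, hc, map_smul, hc, smul_smul, mul_comm]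
  have hnorm : ∀ t, ‖c t‖ = 1 := by
    intro t
    have h := π.norm_map ⟨t, 1⟩ v
    rw [hc', norm_smul] at h
    exact mul_right_cancel₀ hvn (by rw [h, one_mul])
  have hcont : Continuous c := by
    have h1 : ∀ t, c t = inner ℂ v (π.rep ⟨t, 1⟩ v) / inner ℂ v v := by
      intro t
      rw [hc', inner_smul_right, mul_div_cancel_right₀]
      simpa using hv0
    have h2 : c = fun t => inner ℂ v (π.rep ⟨t, 1⟩ v) / inner ℂ v v := funext h1
    rw [h2]
    exact (continuous_const.inner ((π.continuous v).comp (continuous_dih_left 1))).div_const _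
  have hcirc : ∀ t, c t ∈ Submonoid.unitSphere ℂ := fun t => by
    simp [Submonoid.unitSphere, hnorm]
  exact ⟨{ toFun := fun t => ⟨c t, hcirc t⟩
           map_one' := Subtype.ext hone
           map_mul' := fun s t => Subtype.ext (hmul s t)
           continuous_toFun := hcont.subtype_mk _ }, v, hv0, hc'⟩

/-- The matrices of the representation of `T ⋊ ℤ₂` induced from the character `χ` of `T`. -/
noncomputable def inducedMatrix (χ : T →ₜ* Circle) (g : Dih T) : Matrix (Fin 2) (Fin 2) ℂ :=
  if g.right = 1 then !![(χ g.left : ℂ), 0; 0, ((χ⁻¹ : T →ₜ* Circle) g.left : ℂ)]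
  else !![0, (χ g.left : ℂ); ((χ⁻¹ : T →ₜ* Circle) g.left : ℂ), 0]

variable {π}

theorem rep_flip_eigenvector {χ : T →ₜ* Circle} {v : EuclideanSpace ℂ (Fin π.dim)}
    (hv : ∀ t, π.rep ⟨t, 1⟩ v = (χ t : ℂ) • v) (t : T) :
    π.rep ⟨t, 1⟩ (π.rep ⟨1, -1⟩ v) = ((χ⁻¹ : T →ₜ* Circle) t : ℂ) • π.rep ⟨1, -1⟩ v := by
  rw [← Module.End.mul_apply, ← map_mul, dih_mk_mul_flip', map_mul, Module.End.mul_apply, hv,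
    map_smul, map_inv]
  rfl

theorem rep_flip_flip (v : EuclideanSpace ℂ (Fin π.dim)) :
    π.rep ⟨1, -1⟩ (π.rep ⟨1, -1⟩ v) = v := by
  rw [← Module.End.mul_apply, ← map_mul, dih_flip_mul_flip, map_one, Module.End.one_apply]

theorem hasMatrix_induced {χ : T →ₜ* Circle} {v : EuclideanSpace ℂ (Fin π.dim)} (hv0 : v ≠ 0)
    (hv : ∀ t, π.rep ⟨t, 1⟩ v = (χ t : ℂ) • v) (hχ : ∃ t, conj (χ t : ℂ) ≠ χ t) :
    π.HasMatrix (inducedMatrix χ) := by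
  set w := π.rep ⟨1, -1⟩ v with hw
  have hw1 : ∀ t, π.rep ⟨t, 1⟩ w = ((χ⁻¹ : T →ₜ* Circle) t : ℂ) • w := rep_flip_eigenvector hv
  have hw2 : π.rep ⟨1, -1⟩ w = v := rep_flip_flip v
  have hw0 : w ≠ 0 := fun h => hv0 (by rw [← hw2, h, map_zero])
  obtain ⟨s, hs⟩ := hχ
  have hs' : ((χ⁻¹ : T →ₜ* Circle) s : ℂ) = conj (χ s : ℂ) := Circle.coe_inv_eq_conj _
  have hli : LinearIndependent ℂ ![v, w] := by
    refine Module.End.eigenvectors_linearIndependent' (π.rep ⟨s, 1⟩)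
      ![(χ s : ℂ), ((χ⁻¹ : T →ₜ* Circle) s : ℂ)] ?_ _ ?_
    · intro i j hij
      fin_cases i <;> fin_cases j
      · rfl
      · exact absurd (hs'.symm.trans (Eq.symm hij)) hs
      · exact absurd (hs'.symm.trans hij) hs
      · rfl
    · intro i
      fin_cases i
      · exact ⟨Module.End.mem_eigenspace_iff.2 (hv s), hv0⟩
      · exact ⟨Module.End.mem_eigenspace_iff.2 (hw1 s), hw0⟩
  have hspan : Submodule.span ℂ (Set.range ![v, w]) = ⊤ := by
    have hr : Set.range ![v, w] = {v, w} := by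
      simp [Matrix.range_cons, Set.pair_comm]
    rw [hr]
    have hvm : v ∈ Submodule.span ℂ {v, w} := Submodule.subset_span (by simp)
    have hwm : w ∈ Submodule.span ℂ {v, w} := Submodule.subset_span (by simp)
    refine π.eq_top_of_invariant ((Submodule.ne_bot_iff _).2 ⟨v, hvm, hv0⟩) ?_ ?_
    · intro t x hx
      obtain ⟨a, b, rfl⟩ := Submodule.mem_span_pair.1 hx
      rw [map_add, map_smul, map_smul, hv, hw1]
      exact Submodule.add_mem _ (Submodule.smul_mem _ _ (Submodule.smul_mem _ _ hvm))
        (Submodule.smul_mem _ _ (Submodule.smul_mem _ _ hwm))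
    · intro x hx
      obtain ⟨a, b, rfl⟩ := Submodule.mem_span_pair.1 hx
      rw [map_add, map_smul, map_smul, hw2, ← hw]
      exact Submodule.add_mem _ (Submodule.smul_mem _ _ hwm) (Submodule.smul_mem _ _ hvm)
  let b := Module.Basis.mk hli hspan.ge
  have hb0 : b 0 = v := by simp [b]
  have hb1 : b 1 = w := by simp [b]
  refine ⟨b, fun g => ?_⟩
  obtain ⟨t, a⟩ := g
  rcases Int.units_eq_one_or a with rfl | rfl
  · have e0 : π.rep ⟨t, 1⟩ (b 0) = (χ t : ℂ) • b 0 := by rw [hb0, hv]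
    have e1 : π.rep ⟨t, 1⟩ (b 1) = ((χ⁻¹ : T →ₜ* Circle) t : ℂ) • b 1 := by rw [hb1, hw1]
    generalize π.rep ⟨t, 1⟩ = f at e0 e1 ⊢
    ext i j
    rw [LinearMap.toMatrix_apply]
    fin_cases j <;> fin_cases i <;> simp [inducedMatrix, e0, e1]
  · have e0 : π.rep ⟨t, -1⟩ (b 0) = ((χ⁻¹ : T →ₜ* Circle) t : ℂ) • b 1 := by
      rw [hb0, hb1, dih_mk_mul_flip, map_mul, Module.End.mul_apply, ← hw, hw1]
    have e1 : π.rep ⟨t, -1⟩ (b 1) = (χ t : ℂ) • b 0 := by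
      rw [hb0, hb1, dih_mk_mul_flip, map_mul, Module.End.mul_apply, hw2, hv]
    generalize π.rep ⟨t, -1⟩ = f at e0 e1 ⊢
    ext i j
    rw [LinearMap.toMatrix_apply]
    fin_cases j <;> fin_cases i <;> simp [inducedMatrix, e0, e1]

theorem hasMatrix_one_dim {v : EuclideanSpace ℂ (Fin π.dim)} (hv0 : v ≠ 0) {ε : Dih T → ℂ}
    (hv : ∀ g, π.rep g v = ε g • v) :
    π.HasMatrix fun g => (Matrix.of fun _ _ => ε g : Matrix (Fin 1) (Fin 1) ℂ) := by
  have hspan : Submodule.span ℂ (Set.range ![v]) = ⊤ := by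
    have hr : Set.range ![v] = {v} := by simp
    rw [hr]
    have hvm : v ∈ Submodule.span ℂ {v} := Submodule.mem_span_singleton_self v
    have hall : ∀ g, ∀ x ∈ Submodule.span ℂ {v}, π.rep g x ∈ Submodule.span ℂ {v} := by
      intro g x hx
      obtain ⟨a, rfl⟩ := Submodule.mem_span_singleton.1 hx
      rw [map_smul, hv]
      exact Submodule.smul_mem _ _ (Submodule.smul_mem _ _ hvm)
    exact π.eq_top_of_invariant ((Submodule.ne_bot_iff _).2 ⟨v, hvm, hv0⟩)
      (fun t => hall _) (hall _)
  have hli : LinearIndependent ℂ ![v] := by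
    rw [linearIndependent_unique_iff]
    exact hv0
  let b := Module.Basis.mk hli hspan.ge
  have hb0 : b 0 = v := by simp [b]
  refine ⟨b, fun g => ?_⟩
  have e0 : π.rep g (b 0) = ε g • b 0 := by rw [hb0, hv]
  ext i j
  rw [LinearMap.toMatrix_apply]
  fin_cases i
  fin_cases j
  simp [e0]

/-- An irreducible representation is trivial, the sign `σ`, or induced from a nontrivial
character `χ` of `T`, equivalently from `χ⁻¹`. -/
theorem classification (hT : OnlyTrivialRealCharacter T) (π : UnitaryIrrep (Dih T)) :
    π.HasMatrix (fun _ => (Matrix.of fun _ _ => 1 : Matrix (Fin 1) (Fin 1) ℂ)) ∨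
    π.HasMatrix (fun g => (Matrix.of fun _ _ => sgn T g : Matrix (Fin 1) (Fin 1) ℂ)) ∨
    ∃ χ : T →ₜ* Circle, χ ≠ 1 ∧ π.HasMatrix (inducedMatrix χ) ∧
      π.HasMatrix (inducedMatrix χ⁻¹) := by
  obtain ⟨χ, v, hv0, hv⟩ := π.exists_eigenvector
  set w := π.rep ⟨1, -1⟩ v with hw
  have hw2 : π.rep ⟨1, -1⟩ w = v := rep_flip_flip v
  by_cases hreal : ∀ t, conj (χ t : ℂ) = χ t
  · have h1 : ∀ t, χ t = 1 := hT χ hreal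
    have hv1 : ∀ t, π.rep ⟨t, 1⟩ v = v := fun t => by rw [hv, h1]; simp
    have hw1 : ∀ t, π.rep ⟨t, 1⟩ w = w := fun t => by
      have h2 : (χ⁻¹ : T →ₜ* Circle) t = (χ t)⁻¹ := rfl
      rw [hw, rep_flip_eigenvector hv, h2, h1]
      simp
    by_cases hsum : v + w = 0
    · right
      left
      refine hasMatrix_one_dim hv0 fun g => ?_
      obtain ⟨t, a⟩ := g
      rcases Int.units_eq_one_or a with rfl | rfl
      · rw [hv1, sgn_mk_one, one_smul]
      · rw [dih_mk_mul_flip, map_mul, Module.End.mul_apply, ← hw, hw1, ← dih_mk_mul_flip,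
          sgn_mk_neg_one, neg_one_smul]
        exact (neg_eq_of_add_eq_zero_right hsum).symm
    · left
      refine hasMatrix_one_dim hsum fun g => ?_
      obtain ⟨t, a⟩ := g
      rw [one_smul]
      rcases Int.units_eq_one_or a with rfl | rfl
      · rw [map_add, hv1, hw1]
      · rw [dih_mk_mul_flip, map_mul, Module.End.mul_apply, map_add, map_add, ← hw, hw2, hv1, hw1,
          add_comm]
  · push Not at hreal
    right
    right
    refine ⟨χ, ?_, hasMatrix_induced hv0 hv hreal, hasMatrix_induced (v := w)
      (fun h => hv0 (by rw [← hw2, h, map_zero])) (rep_flip_eigenvector hv) ?_⟩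
    · rintro rfl
      obtain ⟨t, ht⟩ := hreal
      simp at ht
    · obtain ⟨t, ht⟩ := hreal
      refine ⟨t, fun h => ht ?_⟩
      have h2 : (((χ⁻¹ : T →ₜ* Circle) t : Circle) : ℂ) = conj (χ t : ℂ) :=
        Circle.coe_inv_eq_conj _
      rw [h2, Complex.conj_conj] at h
      exact h.symm

end UnitaryIrrep

end Irreps

/-! ### The Fourier coefficients of the diagonal measure -/

section FourierCoefficients

variable {T : Type u} [CommGroup T] [TopologicalSpace T]

theorem normChar_inv (π : UnitaryIrrep (Dih T)) (t : T) :
    π.normChar ⟨t⁻¹, 1⟩ = π.normChar ⟨t, 1⟩ := by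
  have h := dih_conj (⟨1, -1⟩ : Dih T) t
  simp only [Units.val_neg, Units.val_one, zpow_neg, zpow_one] at h
  change (π.dim : ℂ)⁻¹ * π.rep.character _ = (π.dim : ℂ)⁻¹ * π.rep.character _
  rw [← h, Representation.char_conj]

theorem normChar_eq_one {π : UnitaryIrrep (Dih T)}
    (hπ : π.HasMatrix fun _ => (Matrix.of fun _ _ => 1 : Matrix (Fin 1) (Fin 1) ℂ)) (g : Dih T) :
    π.normChar g = 1 := by
  rw [hπ.normChar_apply]
  simp [Matrix.trace]

theorem normChar_eq_sgn {π : UnitaryIrrep (Dih T)}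
    (hπ : π.HasMatrix fun g => (Matrix.of fun _ _ => sgn T g : Matrix (Fin 1) (Fin 1) ℂ))
    (g : Dih T) : π.normChar g = sgn T g := by
  rw [hπ.normChar_apply]
  simp [Matrix.trace]

theorem conj_normChar_induced {π : UnitaryIrrep (Dih T)} {χ : T →ₜ* Circle}
    (hπ : π.HasMatrix (UnitaryIrrep.inducedMatrix χ)) (t : T) :
    conj (π.normChar ⟨t, 1⟩) = 2⁻¹ * ((χ t : ℂ) + ((χ⁻¹ : T →ₜ* Circle) t : ℂ)) := by
  have h1 : conj (χ t : ℂ) = ((χ⁻¹ : T →ₜ* Circle) t : ℂ) := (Circle.coe_inv_eq_conj _).symm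
  rw [hπ.normChar_apply]
  simp only [UnitaryIrrep.inducedMatrix, if_true, Matrix.trace_fin_two_of, Fintype.card_fin,
    map_mul, map_add, ← h1, Complex.conj_conj, map_inv₀, map_natCast]
  rw [add_comm, Nat.cast_ofNat]

theorem normChar_induced_neg {π : UnitaryIrrep (Dih T)} {χ : T →ₜ* Circle}
    (hπ : π.HasMatrix (UnitaryIrrep.inducedMatrix χ)) (t : T) :
    π.normChar ⟨t, -1⟩ = 0 := by
  have h : ¬ ((-1 : ℤˣ) = 1) := by decide
  rw [hπ.normChar_apply]
  simp [UnitaryIrrep.inducedMatrix, h]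

variable [IsTopologicalGroup T] [CompactSpace T] [MeasurableSpace T] [BorelSpace T]

theorem integral_character_eq_zero {χ : T →ₜ* Circle} (hχ : χ ≠ 1) :
    ∫ t, (χ t : ℂ) ∂(probHaar T) = 0 := by
  obtain ⟨s, hs⟩ : ∃ s, χ s ≠ 1 := by
    by_contra! h
    exact hχ (ContinuousMonoidHom.ext h)
  have h : ∫ t, (χ (s * t) : ℂ) ∂(probHaar T) = ∫ t, (χ t : ℂ) ∂(probHaar T) :=
    integral_mul_left_eq_self (fun t => (χ t : ℂ)) s
  simp only [map_mul, Circle.coe_mul] at h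
  rw [integral_const_mul] at h
  by_contra h0
  exact hs (Circle.coe_eq_one.1 (mul_right_cancel₀ h0 (by rw [h, one_mul])))

theorem integrable_character (χ : T →ₜ* Circle) :
    Integrable (fun t => (χ t : ℂ)) (probHaar T) :=
  integrable_of_continuous (continuous_subtype_val.comp χ.continuous_toFun)

theorem integral_induced_mul_induced {χ χ' : T →ₜ* Circle} :
    ∫ t, (2⁻¹ * ((χ t : ℂ) + ((χ⁻¹ : T →ₜ* Circle) t : ℂ))) *
        (2⁻¹ * ((χ' t : ℂ) + ((χ'⁻¹ : T →ₜ* Circle) t : ℂ))) ∂(probHaar T) =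
      4⁻¹ * (∫ t, ((χ * χ') t : ℂ) ∂(probHaar T) + ∫ t, ((χ * χ'⁻¹) t : ℂ) ∂(probHaar T) +
        (∫ t, ((χ⁻¹ * χ') t : ℂ) ∂(probHaar T) +
        ∫ t, ((χ⁻¹ * χ'⁻¹) t : ℂ) ∂(probHaar T))) := by
  have h1 : ∀ α β : T →ₜ* Circle, Integrable (fun t => (α t : ℂ) + (β t : ℂ)) (probHaar T) :=
    fun α β => (integrable_character α).add (integrable_character β)
  rw [← integral_add (integrable_character _) (integrable_character _),
    ← integral_add (integrable_character (χ⁻¹ * χ')) (integrable_character _),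
    ← integral_add (h1 _ _) (h1 _ _), ← integral_const_mul]
  refine integral_congr_ae (Eventually.of_forall fun t => ?_)
  have h : ∀ α β : T →ₜ* Circle, (((α * β) t : Circle) : ℂ) = (α t : ℂ) * (β t : ℂ) :=
    fun _ _ => rfl
  simp only [h]
  ring

variable [T2Space T]

/-- The Fourier coefficients through integrals over the two cosets of `T`. The subgroups `D` and
`A` contribute equally, because characters are invariant under inversion on `T`. -/
theorem fourierCoeff_eq (π ρ : UnitaryIrrep (Dih T)) :
    fourierCoeff (diagonalMeasure T) π ρ =
      4⁻¹ * (-6 * (∫ t, conj (π.normChar ⟨t, 1⟩) ∂(probHaar T)) *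
          (∫ t, conj (ρ.normChar ⟨t, 1⟩) ∂(probHaar T)) +
        2 * (∫ t, conj (π.normChar ⟨t, -1⟩) ∂(probHaar T)) *
          (∫ t, conj (ρ.normChar ⟨t, -1⟩) ∂(probHaar T))) +
      2 * ∫ t, conj (π.normChar ⟨t, 1⟩) * conj (ρ.normChar ⟨t, 1⟩) ∂(probHaar T) := by
  have hf : Continuous fun x => conj (π.normChar x) :=
    Complex.continuous_conj.comp π.normChar.continuous
  have hg : Continuous fun x => conj (ρ.normChar x) :=
    Complex.continuous_conj.comp ρ.normChar.continuous
  rw [fourierCoeff, diagonalMeasure_apply]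
  simp only [ContinuousMap.coe_mk, normChar_inv, map_mul]
  rw [add_assoc, ← two_mul]
  congr 1
  set f : Dih T → ℂ := fun x => conj (π.normChar x)
  set g : Dih T → ℂ := fun x => conj (ρ.normChar x)
  have hw : Continuous fun p : Dih T × Dih T => centralDensity T p * (f p.1 * g p.2) :=
    (centralDensity T).continuous.mul ((hf.comp continuous_fst).mul (hg.comp continuous_snd))
  have h1 : ∀ x, ∫ y, centralDensity T (x, y) * (f x * g y) ∂(probHaar (Dih T)) =
      2⁻¹ * (f x * ((1 + sgn T x - 4 * (1 + sgn T x)) * ∫ t, g ⟨t, 1⟩ ∂(probHaar T) +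
        (1 - sgn T x) * ∫ t, g ⟨t, -1⟩ ∂(probHaar T))) := by
    intro x
    rw [integral_dih (F := fun y => centralDensity T (x, y) * (f x * g y))
      (hw.comp (Continuous.prodMk_right x)), smul_eq_mul, mul_add (f x),
      ← integral_const_mul, ← integral_const_mul, ← integral_const_mul, ← integral_const_mul]
    congr 2
    · refine integral_congr_ae (Eventually.of_forall fun t => ?_)
      simp only [centralDensity, ContinuousMap.coe_mk, sgn_mk_one]
      ring
    · refine integral_congr_ae (Eventually.of_forall fun t => ?_)
      simp only [centralDensity, ContinuousMap.coe_mk, sgn_mk_neg_one]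
      ring
  change ∫ x, ∫ y, centralDensity T (x, y) * (f x * g y) ∂(probHaar (Dih T))
    ∂(probHaar (Dih T)) = _
  simp only [h1]
  rw [integral_dih (by fun_prop)]
  simp only [sgn_mk_one, sgn_mk_neg_one]
  have h2 : ∀ (F : T → ℂ) (c d : ℂ), ∫ t, c * (F t * d) ∂(probHaar T) =
      c * d * ∫ t, F t ∂(probHaar T) := fun F c d => by
    rw [← integral_const_mul]
    exact integral_congr_ae (Eventually.of_forall fun t => by ring)
  rw [h2, h2, smul_eq_mul]
  ring

theorem fourierCoeff_of_isEquivalent (hT : OnlyTrivialRealCharacter T)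
    {π ρ : UnitaryIrrep (Dih T)} (h : π.IsEquivalent ρ) :
    fourierCoeff (diagonalMeasure T) π ρ = 1 := by
  rw [fourierCoeff_eq, ← h.normChar_eq]
  rcases UnitaryIrrep.classification hT π with hπ | hπ | ⟨χ, hχ, hπ, -⟩
  · simp only [normChar_eq_one hπ]
    simp
    norm_num
  · simp only [normChar_eq_sgn hπ, sgn_mk_one, sgn_mk_neg_one]
    simp
    norm_num
  · have hsq : χ * χ ≠ 1 := by
      intro hsq
      refine hχ (ContinuousMonoidHom.ext fun t => hT χ (fun s => ?_) t)
      have h1 : χ s = (χ s)⁻¹ := eq_inv_of_mul_eq_one_left (DFunLike.congr_fun hsq s)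
      rw [← Circle.coe_inv_eq_conj, ← h1]
    have hsq' : χ⁻¹ * χ⁻¹ ≠ 1 := by
      rw [← mul_inv_rev, Ne, inv_eq_one]
      exact hsq
    have hχ' : χ⁻¹ ≠ 1 := by rwa [Ne, inv_eq_one]
    simp only [conj_normChar_induced hπ, normChar_induced_neg hπ]
    rw [integral_induced_mul_induced, integral_character_eq_zero hsq,
      integral_character_eq_zero hsq', integral_const_mul,
      integral_add (integrable_character _) (integrable_character _),
      integral_character_eq_zero hχ, integral_character_eq_zero hχ', mul_inv_cancel,
      inv_mul_cancel]
    simp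
    norm_num

theorem fourierCoeff_of_not_isEquivalent (hT : OnlyTrivialRealCharacter T)
    {π ρ : UnitaryIrrep (Dih T)} (h : ¬ π.IsEquivalent ρ) :
    fourierCoeff (diagonalMeasure T) π ρ = 0 := by
  have hz : ∀ {χ : T →ₜ* Circle}, χ ≠ 1 →
      ∫ t, 2⁻¹ * ((χ t : ℂ) + ((χ⁻¹ : T →ₜ* Circle) t : ℂ)) ∂(probHaar T) = 0 := by
    intro χ hχ
    have hχ' : χ⁻¹ ≠ 1 := by rwa [Ne, inv_eq_one]
    rw [integral_const_mul, integral_add (integrable_character _) (integrable_character _),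
      integral_character_eq_zero hχ, integral_character_eq_zero hχ', add_zero, mul_zero]
  rw [fourierCoeff_eq]
  rcases UnitaryIrrep.classification hT π with hπ | hπ | ⟨χ, hχ, hπ, -⟩ <;>
    rcases UnitaryIrrep.classification hT ρ with hρ | hρ | ⟨χ', hχ', hρ, hρ'⟩
  · exact absurd (hπ.isEquivalent hρ) h
  · simp only [normChar_eq_one hπ, normChar_eq_sgn hρ, sgn_mk_one, sgn_mk_neg_one]
    simp
    norm_num
  · simp only [normChar_eq_one hπ, conj_normChar_induced hρ, normChar_induced_neg hρ, hz hχ',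
      map_one, one_mul]
    simp
  · simp only [normChar_eq_one hρ, normChar_eq_sgn hπ, sgn_mk_one, sgn_mk_neg_one]
    simp
    norm_num
  · exact absurd (hπ.isEquivalent hρ) h
  · simp only [normChar_eq_sgn hπ, sgn_mk_one, conj_normChar_induced hρ,
      normChar_induced_neg hρ, hz hχ', map_one, one_mul]
    simp
  · simp only [normChar_eq_one hρ, conj_normChar_induced hπ, normChar_induced_neg hπ, hz hχ,
      map_one, mul_one]
    simp
  · simp only [normChar_eq_sgn hρ, sgn_mk_one, conj_normChar_induced hπ,
      normChar_induced_neg hπ, hz hχ, map_one, mul_one]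
    simp
  · have h1 : χ ≠ χ' := by
      rintro rfl
      exact h (hπ.isEquivalent hρ)
    have h2 : χ ≠ χ'⁻¹ := by
      rintro rfl
      exact h (hπ.isEquivalent hρ')
    simp only [conj_normChar_induced hπ, normChar_induced_neg hπ, conj_normChar_induced hρ,
      normChar_induced_neg hρ, hz hχ, hz hχ']
    rw [integral_induced_mul_induced,
      integral_character_eq_zero (χ := χ * χ') (fun e => h2 (eq_inv_of_mul_eq_one_left e)),
      integral_character_eq_zero (χ := χ * χ'⁻¹) (fun e => h1 (mul_inv_eq_one.1 e)),
      integral_character_eq_zero (χ := χ⁻¹ * χ') (fun e => h1 (inv_mul_eq_one.1 e)),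
      integral_character_eq_zero (χ := χ⁻¹ * χ'⁻¹) (fun e => h2 (inv_mul_eq_one.1 e))]
    simp

end FourierCoefficients

/-! ### Elementary tensors -/

section ElementaryTensors

variable {A : Type u} [NonUnitalNormedRing A] [NormedSpace ℂ A]

theorem norm_elem_le (b c : A) : ‖elem b c‖ ≤ ‖b‖ * ‖c‖ := by
  have h : ‖elem b c‖ = ‖PiTensorProduct.tprod ℂ ![b, c]‖ := UniformSpace.Completion.norm_coe _
  rw [h]
  refine (PiTensorProduct.projectiveSeminorm_tprod_le _).trans_eq ?_
  simp

theorem elem_add_left (b b' c : A) : elem (b + b') c = elem b c + elem b' c := by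
  have h := (PiTensorProduct.tprod ℂ (s := fun _ : Fin 2 => A)).map_update_add ![b, c] 0 b b'
  have e : ∀ d : A, Function.update ![b, c] 0 d = ![d, c] := fun d => by
    ext i
    fin_cases i <;> rfl
  simp only [e] at h
  simp only [elem, ← map_add, ← h]

theorem elem_add_right (b c c' : A) : elem b (c + c') = elem b c + elem b c' := by
  have h := (PiTensorProduct.tprod ℂ (s := fun _ : Fin 2 => A)).map_update_add ![b, c] 1 c c'
  have e : ∀ d : A, Function.update ![b, c] 1 d = ![b, d] := fun d => by
    ext i
    fin_cases i <;> rfl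
  simp only [e] at h
  simp only [elem, ← map_add, ← h]

theorem elem_smul_left (r : ℂ) (b c : A) : elem (r • b) c = r • elem b c := by
  have h := (PiTensorProduct.tprod ℂ (s := fun _ : Fin 2 => A)).map_update_smul ![b, c] 0 r b
  have e : ∀ d : A, Function.update ![b, c] 0 d = ![d, c] := fun d => by
    ext i
    fin_cases i <;> rfl
  simp only [e] at h
  simp only [elem, ← map_smul, ← h]

theorem elem_smul_right (r : ℂ) (b c : A) : elem b (r • c) = r • elem b c := by
  have h := (PiTensorProduct.tprod ℂ (s := fun _ : Fin 2 => A)).map_update_smul ![b, c] 1 r c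
  have e : ∀ d : A, Function.update ![b, c] 1 d = ![b, d] := fun d => by
    ext i
    fin_cases i <;> rfl
  simp only [e] at h
  simp only [elem, ← map_smul, ← h]

variable (A) in
/-- The elementary tensor as a bounded bilinear map. -/
noncomputable def elemL : A →L[ℂ] A →L[ℂ] ProjTensor A :=
  LinearMap.mkContinuous₂ (LinearMap.mk₂ ℂ elem elem_add_left elem_smul_left elem_add_right
    elem_smul_right) 1 (fun b c => by simpa using norm_elem_le b c)

theorem continuous_elem {X : Type*} [TopologicalSpace X] {f g : X → A} (hf : Continuous f)
    (hg : Continuous g) : Continuous fun x => elem (f x) (g x) :=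
  ((elemL A).continuous.comp hf).clm_apply hg

end ElementaryTensors

/-! ### Symmetrised translations -/

section Symmetrised

variable {T : Type u} [CommGroup T]

theorem mk_one_mul_mk_one (s t : T) : (⟨s, 1⟩ : Dih T) * ⟨t, 1⟩ = ⟨s * t, 1⟩ :=
  SemidirectProduct.ext (by change s * t ^ ((1 : ℤˣ) : ℤ) = s * t; simp) (one_mul 1)

theorem dih_mul_comm_or (t : T) (y : Dih T) :
    ((⟨t, 1⟩ : Dih T) * y = y * ⟨t, 1⟩ ∧ (⟨t⁻¹, 1⟩ : Dih T) * y = y * ⟨t⁻¹, 1⟩) ∨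
    ((⟨t, 1⟩ : Dih T) * y = y * ⟨t⁻¹, 1⟩ ∧ (⟨t⁻¹, 1⟩ : Dih T) * y = y * ⟨t, 1⟩) := by
  have h : ∀ s : T, y * (⟨s, 1⟩ : Dih T) = ⟨s ^ (y.right : ℤ), 1⟩ * y := fun s => by
    rw [← dih_conj, inv_mul_cancel_right]
  rcases Int.units_eq_one_or y.right with hy | hy
  · left
    simp only [h, hy, Units.val_one, zpow_one, and_self]
  · right
    simp only [h, hy, Units.val_one, Units.val_neg, zpow_neg, zpow_one, inv_inv, and_self]

variable [TopologicalSpace T] [IsTopologicalGroup T] [CompactSpace T]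

/-- Convolution on `L¹(T ⋊ ℤ₂)` by the central measure `½ (δ_t + δ_{t⁻¹})`. -/
noncomputable def symmTranslateL1 (t : T) : L1 (Dih T) →L[ℂ] L1 (Dih T) :=
  (2⁻¹ : ℂ) • ((translate (⟨t, 1⟩ : Dih T)).toContinuousLinearMap +
    (translate (⟨t⁻¹, 1⟩ : Dih T)).toContinuousLinearMap)

theorem symmTranslateL1_apply (t : T) (f : L1 (Dih T)) :
    symmTranslateL1 t f = (2⁻¹ : ℂ) • (translate ⟨t, 1⟩ f + translate ⟨t⁻¹, 1⟩ f) := rfl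

theorem symmTranslateL1_mul (t : T) (f g : L1 (Dih T)) :
    symmTranslateL1 t (f * g) = symmTranslateL1 t f * g := by
  have h : ∀ y : Dih T, translate y (f * g) = translate y f * g := fun y => translate_conv y f g
  rw [symmTranslateL1_apply, symmTranslateL1_apply, h, h, smul_mul_assoc, add_mul]

theorem symmTranslateL1_translate (t : T) (y : Dih T) (f : L1 (Dih T)) :
    symmTranslateL1 t (translate y f) = translate y (symmTranslateL1 t f) := by
  rw [symmTranslateL1_apply, symmTranslateL1_apply, map_smul, map_add]
  simp only [translate_translate]
  rcases dih_mul_comm_or t y with ⟨h1, h2⟩ | ⟨h1, h2⟩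
  · rw [h1, h2]
  · rw [h1, h2, add_comm]

theorem symmTranslateL1_mul' (t : T) (f g : L1 (Dih T)) :
    symmTranslateL1 t (f * g) = f * symmTranslateL1 t g := by
  rw [L1.mul_def, ← (symmTranslateL1 t).integral_comp_comm (integrable_conv f g)]
  simp only [map_smul, symmTranslateL1_translate]
  rfl

theorem norm_symmTranslateL1_le (t : T) (f : L1 (Dih T)) : ‖symmTranslateL1 t f‖ ≤ ‖f‖ := by
  rw [symmTranslateL1_apply, norm_smul]
  have h := norm_add_le (translate (⟨t, 1⟩ : Dih T) f) (translate (⟨t⁻¹, 1⟩ : Dih T) f)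
  simp only [LinearIsometry.norm_map] at h
  have h2 : ‖(2⁻¹ : ℂ)‖ = 2⁻¹ := by simp
  rw [h2]
  linarith

theorem symmTranslateL1_mem (t : T) {f : L1 (Dih T)} (hf : f ∈ ZL1 (Dih T)) :
    symmTranslateL1 t f ∈ ZL1 (Dih T) := by
  rw [mem_ZL1_iff] at hf ⊢
  intro g
  rw [← symmTranslateL1_mul, hf, symmTranslateL1_mul']

theorem continuous_symmTranslateL1 (f : L1 (Dih T)) :
    Continuous fun t : T => symmTranslateL1 t f := by
  simp only [symmTranslateL1_apply]
  have h : Continuous fun t : T => translate (⟨t, 1⟩ : Dih T) f :=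
    (continuous_translate f).comp (continuous_dih_left 1)
  exact (h.add (h.comp continuous_inv)).const_smul (2⁻¹ : ℂ)

theorem symmTranslateL1_symmTranslateL1 (s t : T) (f : L1 (Dih T)) :
    symmTranslateL1 s (symmTranslateL1 t f) =
      (2⁻¹ : ℂ) • (symmTranslateL1 (s * t) f + symmTranslateL1 (s⁻¹ * t) f) := by
  simp only [symmTranslateL1_apply, map_smul, map_add, translate_translate, mk_one_mul_mk_one,
    mul_inv, inv_inv]
  module

/-- The inclusion of the centre in the group algebra. -/
noncomputable def ZL1.val : ZL1 (Dih T) →L[ℂ] L1 (Dih T) where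
  toFun x := x
  map_add' _ _ := rfl
  map_smul' _ _ := rfl
  cont := continuous_subtype_val

theorem ZL1.val_apply (x : ZL1 (Dih T)) : ZL1.val x = (x : L1 (Dih T)) := rfl

theorem ZL1.val_injective : Function.Injective (ZL1.val (T := T)) := Subtype.val_injective

theorem ZL1.mul_comm' (x y : ZL1 (Dih T)) : x * y = y * x :=
  Subtype.ext ((mem_ZL1_iff _ _).1 x.2 y)

/-- Convolution on `ZL¹(T ⋊ ℤ₂)` by the central measure `½ (δ_t + δ_{t⁻¹})`. -/
noncomputable def symmTranslate (t : T) : ZL1 (Dih T) →L[ℂ] ZL1 (Dih T) where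
  toFun x := ⟨symmTranslateL1 t x, symmTranslateL1_mem t x.2⟩
  map_add' x y := Subtype.ext (map_add (symmTranslateL1 t) (x : L1 (Dih T)) y)
  map_smul' c x := Subtype.ext (map_smul (symmTranslateL1 t) c (x : L1 (Dih T)))
  cont := ((symmTranslateL1 t).continuous.comp continuous_subtype_val).subtype_mk _

theorem coe_symmTranslate (t : T) (x : ZL1 (Dih T)) :
    (symmTranslate t x : L1 (Dih T)) = symmTranslateL1 t x := rfl

theorem symmTranslate_mul (t : T) (x y : ZL1 (Dih T)) :
    symmTranslate t (x * y) = symmTranslate t x * y := Subtype.ext (symmTranslateL1_mul t x y)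

theorem symmTranslate_mul' (t : T) (x y : ZL1 (Dih T)) :
    symmTranslate t (x * y) = x * symmTranslate t y := Subtype.ext (symmTranslateL1_mul' t x y)

theorem norm_symmTranslate_le (t : T) (x : ZL1 (Dih T)) : ‖symmTranslate t x‖ ≤ ‖x‖ :=
  norm_symmTranslateL1_le t x

theorem continuous_symmTranslate (x : ZL1 (Dih T)) : Continuous fun t : T => symmTranslate t x :=
  (continuous_symmTranslateL1 (x : L1 (Dih T))).subtype_mk _

theorem symmTranslate_symmTranslate (s t : T) (x : ZL1 (Dih T)) :
    symmTranslate s (symmTranslate t x) =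
      (2⁻¹ : ℂ) • (symmTranslate (s * t) x + symmTranslate (s⁻¹ * t) x) :=
  Subtype.ext (symmTranslateL1_symmTranslateL1 s t x)

theorem symmTranslate_one (x : ZL1 (Dih T)) : symmTranslate 1 x = x := by
  refine Subtype.ext ?_
  rw [coe_symmTranslate, symmTranslateL1_apply, inv_one]
  have h : translate (⟨1, 1⟩ : Dih T) (x : L1 (Dih T)) = x := translate_one _
  rw [h]
  module

end Symmetrised

/-! ### The constant function and the sign in the centre -/

section OneAndSign

variable {T : Type u} [CommGroup T] [TopologicalSpace T] [IsTopologicalGroup T] [CompactSpace T]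

variable (T) in
/-- The constant function `1` as an element of `ZL¹(T ⋊ ℤ₂)`. -/
noncomputable def oneZ : ZL1 (Dih T) :=
  ⟨L1.mk (1 : C(Dih T, ℂ)) (integrable_probHaar 1), mk_mem_ZL1 _ fun _ _ => rfl⟩

variable (T) in
/-- The character `σ` as an element of `ZL¹(T ⋊ ℤ₂)`. -/
noncomputable def sgnZ : ZL1 (Dih T) :=
  ⟨L1.mk (sgn T) (integrable_probHaar _), mk_mem_ZL1 _ sgn_conj⟩

theorem coe_oneZ : (oneZ T : L1 (Dih T)) = L1.mk (1 : C(Dih T, ℂ)) (integrable_probHaar 1) := rfl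

theorem coe_sgnZ : (sgnZ T : L1 (Dih T)) = L1.mk (sgn T) (integrable_probHaar _) := rfl

theorem pair_one_mul (f g : L1 (Dih T)) : pair 1 (f * g) = pair 1 f * pair 1 g := by
  rw [pair_mul, pair_apply, pair_apply]
  simp [integral_mul_const]

theorem pair_sgn_mul (f g : L1 (Dih T)) :
    pair (sgn T) (f * g) = pair (sgn T) f * pair (sgn T) g := by
  rw [pair_mul, pair_apply, pair_apply, ← integral_mul_const]
  refine integral_congr_ae (Eventually.of_forall fun t => ?_)
  have h : ∀ s, g.fn s * sgn T (t * s) = sgn T t * (g.fn s * sgn T s) := fun s => by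
    rw [sgn_mul, mul_left_comm]
  simp only [h]
  rw [integral_const_mul, mul_assoc]

theorem mul_oneZ (x : ZL1 (Dih T)) : x * oneZ T = pair 1 (x : L1 (Dih T)) • oneZ T := by
  refine Subtype.ext (L1.ext_pair fun h => ?_)
  change pair h ((x : L1 (Dih T)) * (oneZ T : L1 (Dih T))) =
    pair h (pair 1 (x : L1 (Dih T)) • (oneZ T : L1 (Dih T)))
  rw [← (mem_ZL1_iff _ _).1 (oneZ T).2, coe_oneZ, pair_mul', map_smul, pair_mk, pair_apply,
    smul_eq_mul, ← integral_mul_const]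
  refine integral_congr_ae (Eventually.of_forall fun t => ?_)
  simp only [ContinuousMap.one_apply, one_mul, mul_one]
  congr 1
  have e := integral_mul_right_eq_self (μ := probHaar (Dih T)) (fun y => h y) t
  rw [← e]
  refine integral_congr_ae ?_
  filter_upwards [L1.fn_mk (integrable_probHaar (1 : C(Dih T, ℂ)))] with y hy
  rw [hy, ContinuousMap.one_apply, one_mul]

theorem mul_sgnZ (x : ZL1 (Dih T)) : x * sgnZ T = pair (sgn T) (x : L1 (Dih T)) • sgnZ T := by
  refine Subtype.ext (L1.ext_pair fun h => ?_)
  change pair h ((x : L1 (Dih T)) * (sgnZ T : L1 (Dih T))) =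
    pair h (pair (sgn T) (x : L1 (Dih T)) • (sgnZ T : L1 (Dih T)))
  rw [← (mem_ZL1_iff _ _).1 (sgnZ T).2, coe_sgnZ, pair_mul', map_smul, pair_mk, pair_apply,
    smul_eq_mul, ← integral_mul_const]
  refine integral_congr_ae (Eventually.of_forall fun t => ?_)
  simp only [mul_assoc]
  congr 1
  have e := integral_mul_right_eq_self (μ := probHaar (Dih T)) (fun y => sgn T y * h y) t
  rw [← e, ← integral_const_mul]
  refine integral_congr_ae ?_
  filter_upwards [L1.fn_mk (integrable_probHaar (sgn T))] with y hy
  rw [hy, sgn_mul, ← mul_assoc, mul_left_comm, sgn_sq, mul_one]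

theorem pair_one_oneZ : pair 1 (oneZ T : L1 (Dih T)) = 1 := by
  rw [coe_oneZ, pair_mk]
  simp

theorem pair_sgn_oneZ : pair (sgn T) (oneZ T : L1 (Dih T)) = 0 := by
  rw [coe_oneZ, pair_mk]
  simpa using integral_sgn

theorem pair_sgn_sgnZ : pair (sgn T) (sgnZ T : L1 (Dih T)) = 1 := by
  rw [coe_sgnZ, pair_mk]
  simp [sgn_sq]

variable [MeasurableSpace T] [BorelSpace T]

/-- The mean of `x` over the translates by `T` is determined by the integrals of `x` over `T`
and over the other coset. -/
theorem integral_symmTranslate (x : ZL1 (Dih T)) :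
    ∫ t, symmTranslate t x ∂(probHaar T) =
      pair 1 (x : L1 (Dih T)) • oneZ T + pair (sgn T) (x : L1 (Dih T)) • sgnZ T := by
  refine ZL1.val_injective ?_
  rw [← mul_oneZ, ← mul_sgnZ, ZL1.mul_comm' x, ZL1.mul_comm' x, ← ZL1.val.integral_comp_comm
    (integrable_of_continuous (continuous_symmTranslate x))]
  simp only [ZL1.val_apply, coe_symmTranslate, symmTranslateL1_apply]
  have hc : Continuous fun t : T => translate (⟨t, 1⟩ : Dih T) (x : L1 (Dih T)) :=
    (continuous_translate _).comp (continuous_dih_left 1)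
  have hc' : Continuous fun t : T => translate (⟨t⁻¹, 1⟩ : Dih T) (x : L1 (Dih T)) :=
    hc.comp continuous_inv
  have h1 : ∫ t : T, translate (⟨t⁻¹, 1⟩ : Dih T) (x : L1 (Dih T)) ∂(probHaar T) =
      ∫ t : T, translate (⟨t, 1⟩ : Dih T) (x : L1 (Dih T)) ∂(probHaar T) :=
    integral_inv_eq_self (fun t : T => translate (⟨t, 1⟩ : Dih T) (x : L1 (Dih T))) _
  rw [integral_smul, integral_add (integrable_of_continuous hc)
    (integrable_of_continuous hc'), h1]
  have h2 : ((oneZ T * x + sgnZ T * x : ZL1 (Dih T)) : L1 (Dih T)) =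
      ∫ y, (1 + sgn T y) • translate y (x : L1 (Dih T)) ∂(probHaar (Dih T)) := by
    simp only [add_smul]
    have i1 : Integrable (fun y => (1 : ℂ) • translate y (x : L1 (Dih T))) (probHaar (Dih T)) :=
      integrable_smul_continuous (integrable_const 1) (continuous_translate _)
    rw [integral_add i1
      (integrable_smul_continuous (integrable_probHaar (sgn T)) (continuous_translate _))]
    change L1.mk _ _ * (x : L1 (Dih T)) + L1.mk _ _ * (x : L1 (Dih T)) = _
    rw [L1.mul_def, L1.mul_def]
    congr 1
    · refine integral_congr_ae ?_
      filter_upwards [L1.fn_mk (integrable_probHaar (1 : C(Dih T, ℂ)))] with y hy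
      rw [hy]
      rfl
    · refine integral_congr_ae ?_
      filter_upwards [L1.fn_mk (integrable_probHaar (sgn T))] with y hy
      rw [hy]
  rw [h2, integral_dih (F := fun y => (1 + sgn T y) • translate y (x : L1 (Dih T)))
    ((continuous_const.add (sgn T).continuous).smul (continuous_translate _))]
  simp only [sgn_mk_one, sgn_mk_neg_one]
  rw [integral_smul]
  simp only [add_neg_cancel, zero_smul, integral_zero]
  module

end OneAndSign

/-! ### Multiplication by a central element -/

section CentralMultiplication

variable {T : Type u} [CommGroup T] [TopologicalSpace T] [IsTopologicalGroup T] [CompactSpace T]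

/-- On the coset `T`, a central element is invariant under inversion. -/
theorem integral_central_even {a : L1 (Dih T)} (ha : a ∈ ZL1 (Dih T)) (Φ : C(Dih T, ℂ)) :
    ∫ y, a.fn y * (2⁻¹ * (1 + sgn T y) * Φ y) ∂(probHaar (Dih T)) =
      ∫ y, a.fn y * (2⁻¹ * (1 + sgn T y) *
        (2⁻¹ * (Φ ⟨y.left, 1⟩ + Φ ⟨y.left⁻¹, 1⟩))) ∂(probHaar (Dih T)) := by
  have hl : Continuous fun y : Dih T => (⟨y.left, 1⟩ : Dih T) :=
    continuous_dih_mk T (continuous_left T) continuous_const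
  have hr : Continuous fun y : Dih T => (⟨y.left⁻¹, 1⟩ : Dih T) :=
    continuous_dih_mk T (continuous_left T).inv continuous_const
  let H : C(Dih T, ℂ) := ⟨fun y => 2⁻¹ * (1 + sgn T y) * Φ y, by fun_prop⟩
  have h1 := pair_conj_of_mem_ZL1 ha H ⟨1, -1⟩
  rw [pair_apply] at h1
  have e1 : ∀ y, H y = 2⁻¹ * (1 + sgn T y) * Φ ⟨y.left, 1⟩ := by
    rintro ⟨s, b⟩
    rcases Int.units_eq_one_or b with rfl | rfl
    · rfl
    · simp only [H, ContinuousMap.coe_mk, sgn_mk_neg_one]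
      ring
  have e2 : ∀ y, H (⟨1, -1⟩ * y * (⟨1, -1⟩ : Dih T)⁻¹) =
      2⁻¹ * (1 + sgn T y) * Φ ⟨y.left⁻¹, 1⟩ := by
    rintro ⟨s, b⟩
    rcases Int.units_eq_one_or b with rfl | rfl
    · rw [dih_conj]
      simp only [H, ContinuousMap.coe_mk, sgn_mk_one, Units.val_neg, Units.val_one, zpow_neg,
        zpow_one]
    · simp only [H, ContinuousMap.coe_mk, sgn_conj, sgn_mk_neg_one]
      ring
  have e3 : ∀ y, a.fn y * (2⁻¹ * (1 + sgn T y) *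
        (2⁻¹ * (Φ ⟨y.left, 1⟩ + Φ ⟨y.left⁻¹, 1⟩))) = 2⁻¹ * (a.fn y * H y +
        a.fn y * H (⟨1, -1⟩ * y * (⟨1, -1⟩ : Dih T)⁻¹)) := by
    intro y
    rw [e1, e2]
    ring
  have i1 : Integrable (fun y => a.fn y * H y) (probHaar (Dih T)) :=
    integrable_smul_continuous a.integrable_fn H.continuous
  have i2 : Integrable (fun y => a.fn y * H (⟨1, -1⟩ * y * (⟨1, -1⟩ : Dih T)⁻¹))
      (probHaar (Dih T)) :=
    integrable_smul_continuous a.integrable_fn (by fun_prop)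
  simp only [e3]
  rw [integral_const_mul, integral_add i1 i2, h1]
  change ∫ y, a.fn y * H y ∂(probHaar (Dih T)) = _
  ring

/-- On the coset of `(1, -1)`, a central element is constant: it is invariant under translation
by all squares in `T`. -/
theorem integral_central_odd [T2Space T] [MeasurableSpace T] [BorelSpace T]
    (hsq : Function.Surjective fun t : T => t * t) {a : L1 (Dih T)}
    (ha : a ∈ ZL1 (Dih T)) (Φ : C(Dih T, ℂ)) :
    ∫ y, a.fn y * (2⁻¹ * (1 - sgn T y) * Φ y) ∂(probHaar (Dih T)) =
      2⁻¹ * (pair 1 a - pair (sgn T) a) *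
        ∫ y, (1 - sgn T y) * Φ y ∂(probHaar (Dih T)) := by
  let H : C(Dih T, ℂ) := ⟨fun y => 2⁻¹ * (1 - sgn T y) * Φ y, by fun_prop⟩
  have hH1 : ∀ s : T, H ⟨s, 1⟩ = 0 := fun s => by
    simp only [H, ContinuousMap.coe_mk, sgn_mk_one]
    ring
  have hHn : ∀ s : T, H ⟨s, -1⟩ = Φ ⟨s, -1⟩ := fun s => by
    simp only [H, ContinuousMap.coe_mk, sgn_mk_neg_one]
    ring
  have hinv : ∀ v : T, ∫ y, a.fn y * H (⟨v, 1⟩ * y) ∂(probHaar (Dih T)) = pair H a := by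
    intro v
    obtain ⟨u, rfl⟩ := hsq v
    rw [← pair_conj_of_mem_ZL1 ha H ⟨u, 1⟩]
    refine integral_congr_ae (Eventually.of_forall fun y => ?_)
    simp only
    congr 1
    obtain ⟨s, b⟩ := y
    have hinv1 : (⟨u, 1⟩ : Dih T)⁻¹ = ⟨u⁻¹, 1⟩ := by
      refine inv_eq_of_mul_eq_one_right ?_
      rw [mk_one_mul_mk_one, mul_inv_cancel]
      rfl
    rcases Int.units_eq_one_or b with rfl | rfl
    · rw [hinv1, mk_one_mul_mk_one, mk_one_mul_mk_one, mk_one_mul_mk_one, hH1, hH1]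
    · congr 1
      rw [hinv1]
      refine SemidirectProduct.ext ?_ ?_
      · change u * u * s ^ ((1 : ℤˣ) : ℤ) =
          u * s ^ ((1 : ℤˣ) : ℤ) * u⁻¹ ^ (((1 * -1 : ℤˣ)) : ℤ)
        simp [mul_right_comm]
      · change (1 : ℤˣ) * -1 = 1 * -1 * 1
        simp
  have hmean : ∀ y : Dih T, ∫ v : T, H (⟨v, 1⟩ * y) ∂(probHaar T) =
      2⁻¹ * (1 - sgn T y) * ∫ v : T, Φ ⟨v, -1⟩ ∂(probHaar T) := by
    rintro ⟨s, b⟩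
    rcases Int.units_eq_one_or b with rfl | rfl
    · simp only [mk_one_mul_mk_one, hH1, sgn_mk_one]
      simp
    · have e : ∀ v : T, (⟨v, 1⟩ : Dih T) * ⟨s, -1⟩ = ⟨v * s, -1⟩ := fun v =>
        SemidirectProduct.ext (by change v * s ^ ((1 : ℤˣ) : ℤ) = v * s; simp)
          (by change (1 : ℤˣ) * -1 = -1; simp)
      simp only [e, hHn, sgn_mk_neg_one]
      rw [integral_mul_right_eq_self (fun v => Φ ⟨v, -1⟩) s]
      ring
  have hc : Continuous fun p : Dih T × T => H ((⟨p.2, 1⟩ : Dih T) * p.1) :=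
    H.continuous.comp (((continuous_dih_left 1).comp continuous_snd).mul continuous_fst)
  have h1 : pair H a = ∫ y, a.fn y *
      (2⁻¹ * (1 - sgn T y) * ∫ v : T, Φ ⟨v, -1⟩ ∂(probHaar T)) ∂(probHaar (Dih T)) := by
    have h2 := integral_smul_integral_swap (ν := probHaar T) a.integrable_fn
      (F := fun y v => H ((⟨v, 1⟩ : Dih T) * y)) hc
    simp only [smul_eq_mul, hinv, hmean] at h2
    rw [h2]
    simp
  have h3 : ∫ y, (1 - sgn T y) * Φ y ∂(probHaar (Dih T)) = ∫ v : T, Φ ⟨v, -1⟩ ∂(probHaar T) := by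
    rw [integral_dih (F := fun y => (1 - sgn T y) * Φ y) (by fun_prop)]
    simp only [sgn_mk_one, sgn_mk_neg_one]
    rw [integral_const_mul, integral_const_mul, smul_eq_mul]
    ring
  rw [h3]
  refine h1.trans ?_
  generalize ∫ v : T, Φ ⟨v, -1⟩ ∂(probHaar T) = k
  have i1 : Integrable (fun y => a.fn y * (1 : C(Dih T, ℂ)) y) (probHaar (Dih T)) :=
    integrable_smul_continuous a.integrable_fn (ContinuousMap.continuous _)
  have i2 : Integrable (fun y => a.fn y * sgn T y) (probHaar (Dih T)) :=
    integrable_smul_continuous a.integrable_fn (ContinuousMap.continuous _)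
  rw [pair_apply, pair_apply, ← integral_sub i1 i2, ← integral_const_mul, ← integral_mul_const]
  refine integral_congr_ae (Eventually.of_forall fun y => ?_)
  simp only [ContinuousMap.one_apply]
  ring

/-- The restriction of `a` to the subgroup `T`. -/
noncomputable def evenWeight (a : L1 (Dih T)) (y : Dih T) : ℂ := a.fn y * (2⁻¹ * (1 + sgn T y))

theorem integrable_evenWeight (a : L1 (Dih T)) :
    Integrable (evenWeight a) (probHaar (Dih T)) :=
  integrable_smul_continuous a.integrable_fn (by fun_prop)

theorem continuous_symmTranslate_left (x : ZL1 (Dih T)) :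
    Continuous fun y : Dih T => symmTranslate y.left x :=
  (continuous_symmTranslate x).comp (continuous_left T)

/-- A central element acts on the centre as a mean of the symmetrised translations plus a
multiple of `1 - σ`. -/
theorem central_mul [T2Space T] [MeasurableSpace T] [BorelSpace T]
    (hsq : Function.Surjective fun t : T => t * t) (a x : ZL1 (Dih T)) :
    a * x = ∫ y, evenWeight (a : L1 (Dih T)) y • symmTranslate y.left x ∂(probHaar (Dih T)) +
      (2⁻¹ * (pair 1 (a : L1 (Dih T)) - pair (sgn T) (a : L1 (Dih T)))) •
        (pair 1 (x : L1 (Dih T)) • oneZ T - pair (sgn T) (x : L1 (Dih T)) • sgnZ T) := by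
  refine ZL1.val_injective ?_
  refine L1.ext_pair fun h => ?_
  have hcomm := ((pair h).comp ZL1.val).integral_comp_comm (integrable_smul_continuous
    (integrable_evenWeight (a : L1 (Dih T))) (continuous_symmTranslate_left x))
  simp only [ContinuousLinearMap.comp_apply] at hcomm
  rw [map_add, map_add, ← hcomm]
  simp only [map_smul, ZL1.val_apply]
  let Φ : C(Dih T, ℂ) := ⟨fun y => pair h (translate y (x : L1 (Dih T))),
    (pair h).continuous.comp (continuous_translate _)⟩
  have h0 : pair h ((a * x : ZL1 (Dih T)) : L1 (Dih T)) =
      ∫ y, (a : L1 (Dih T)).fn y * Φ y ∂(probHaar (Dih T)) := by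
    change pair h ((a : L1 (Dih T)) * (x : L1 (Dih T))) = _
    rw [L1.mul_def, ← (pair h).integral_comp_comm (integrable_conv _ _)]
    simp only [map_smul]
    rfl
  have i1 : Integrable (fun y => (a : L1 (Dih T)).fn y * (2⁻¹ * (1 + sgn T y) * Φ y))
      (probHaar (Dih T)) := integrable_smul_continuous (L1.integrable_fn _) (by fun_prop)
  have i2 : Integrable (fun y => (a : L1 (Dih T)).fn y * (2⁻¹ * (1 - sgn T y) * Φ y))
      (probHaar (Dih T)) := integrable_smul_continuous (L1.integrable_fn _) (by fun_prop)
  have hsplit : ∫ y, (a : L1 (Dih T)).fn y * Φ y ∂(probHaar (Dih T)) =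
      ∫ y, (a : L1 (Dih T)).fn y * (2⁻¹ * (1 + sgn T y) * Φ y) ∂(probHaar (Dih T)) +
      ∫ y, (a : L1 (Dih T)).fn y * (2⁻¹ * (1 - sgn T y) * Φ y) ∂(probHaar (Dih T)) := by
    rw [← integral_add i1 i2]
    refine integral_congr_ae (Eventually.of_forall fun y => ?_)
    simp only
    ring
  rw [h0, hsplit, integral_central_even a.2, integral_central_odd hsq a.2]
  congr 1
  · refine integral_congr_ae (Eventually.of_forall fun y => ?_)
    simp only [coe_symmTranslate, symmTranslateL1_apply, map_smul, map_add, smul_eq_mul,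
      evenWeight, Φ, ContinuousMap.coe_mk]
    ring
  · rw [smul_eq_mul]
    congr 1
    have h4 : ((pair 1 (x : L1 (Dih T)) • oneZ T - pair (sgn T) (x : L1 (Dih T)) • sgnZ T :
        ZL1 (Dih T)) : L1 (Dih T)) = (oneZ T : L1 (Dih T)) * (x : L1 (Dih T)) -
          (sgnZ T : L1 (Dih T)) * (x : L1 (Dih T)) := by
      rw [← mul_oneZ, ← mul_sgnZ, ZL1.mul_comm' x, ZL1.mul_comm' x]
      rfl
    rw [h4, map_sub, coe_oneZ, coe_sgnZ, L1.mul_def, L1.mul_def,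
      ← (pair h).integral_comp_comm (integrable_conv _ _),
      ← (pair h).integral_comp_comm (integrable_conv _ _)]
    have j1 : ∫ y, pair h ((L1.mk (1 : C(Dih T, ℂ)) (integrable_probHaar 1)).fn y •
        translate y (x : L1 (Dih T))) ∂(probHaar (Dih T)) =
        ∫ y, Φ y ∂(probHaar (Dih T)) := by
      refine integral_congr_ae ?_
      filter_upwards [L1.fn_mk (integrable_probHaar (1 : C(Dih T, ℂ)))] with y hy
      rw [hy, ContinuousMap.one_apply, one_smul]
      rfl
    have j2 : ∫ y, pair h ((L1.mk (sgn T) (integrable_probHaar _)).fn y •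
        translate y (x : L1 (Dih T))) ∂(probHaar (Dih T)) =
        ∫ y, sgn T y * Φ y ∂(probHaar (Dih T)) := by
      refine integral_congr_ae ?_
      filter_upwards [L1.fn_mk (integrable_probHaar (sgn T))] with y hy
      rw [hy, map_smul]
      rfl
    have j3 : Integrable (fun y => sgn T y * Φ y) (probHaar (Dih T)) :=
      integrable_smul_continuous (integrable_probHaar (sgn T)) Φ.continuous
    rw [j1, j2, ← integral_sub (integrable_probHaar Φ) j3]
    refine integral_congr_ae (Eventually.of_forall fun y => ?_)
    simp only
    ring

end CentralMultiplication

/-! ### The approximate diagonal -/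

section ElementaryTensors

variable {A : Type u} [NonUnitalNormedRing A] [NormedSpace ℂ A] [CompleteSpace A]
  {X : Type*} [MeasurableSpace X] {μ : Measure X} {f : X → A}

theorem elem_integral_left (hf : Integrable f μ) (c : A) :
    elem (∫ x, f x ∂μ) c = ∫ x, elem (f x) c ∂μ :=
  (((elemL A).flip c).integral_comp_comm hf).symm

theorem elem_integral_right (hf : Integrable f μ) (b : A) :
    elem b (∫ x, f x ∂μ) = ∫ x, elem b (f x) ∂μ :=
  ((elemL A b).integral_comp_comm hf).symm

end ElementaryTensors

section Diagonal

variable {T : Type u} [CommGroup T] [TopologicalSpace T] [IsTopologicalGroup T] [CompactSpace T]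

theorem pair_one_symmTranslate (t : T) (x : ZL1 (Dih T)) :
    pair 1 (symmTranslate t x : L1 (Dih T)) = pair 1 (x : L1 (Dih T)) := by
  have h : ∀ y : Dih T, pair 1 (translate y (x : L1 (Dih T))) = pair 1 (x : L1 (Dih T)) :=
    fun y => by rw [pair_translate]; rfl
  rw [coe_symmTranslate, symmTranslateL1_apply, map_smul, map_add, h, h, smul_eq_mul]
  ring

theorem pair_sgn_symmTranslate (t : T) (x : ZL1 (Dih T)) :
    pair (sgn T) (symmTranslate t x : L1 (Dih T)) = pair (sgn T) (x : L1 (Dih T)) := by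
  have h : ∀ s : T, pair (sgn T) (translate (⟨s, 1⟩ : Dih T) (x : L1 (Dih T))) =
      pair (sgn T) (x : L1 (Dih T)) := fun s => by
    rw [pair_translate]
    simp only [sgn_mul, sgn_mk_one, one_mul]
    rfl
  rw [coe_symmTranslate, symmTranslateL1_apply, map_smul, map_add, h, h, smul_eq_mul]
  ring

/-- Convolution by the part of `a` supported on the coset `T`, written through the symmetrised
translations. -/
noncomputable def evenAct (a : L1 (Dih T)) (x : ZL1 (Dih T)) : ZL1 (Dih T) :=
  ∫ y, evenWeight a y • symmTranslate y.left x ∂(probHaar (Dih T))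

theorem integrable_evenWeight_smul (a : L1 (Dih T)) (x : ZL1 (Dih T)) :
    Integrable (fun y => evenWeight a y • symmTranslate y.left x) (probHaar (Dih T)) :=
  integrable_smul_continuous (integrable_evenWeight a) (continuous_symmTranslate_left x)

theorem elem_evenAct_left (a : L1 (Dih T)) (x z : ZL1 (Dih T)) :
    elem (evenAct a x) z =
      ∫ y, evenWeight a y • elem (symmTranslate y.left x) z ∂(probHaar (Dih T)) := by
  rw [evenAct, elem_integral_left (integrable_evenWeight_smul a x)]
  simp only [elem_smul_left]

theorem elem_evenAct_right (a : L1 (Dih T)) (x z : ZL1 (Dih T)) :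
    elem z (evenAct a x) =
      ∫ y, evenWeight a y • elem z (symmTranslate y.left x) ∂(probHaar (Dih T)) := by
  rw [evenAct, elem_integral_right (integrable_evenWeight_smul a x)]
  simp only [elem_smul_right]

theorem continuous_symmTranslate_left_symmTranslate (e : ZL1 (Dih T)) {X : Type*}
    [TopologicalSpace X] {f : X → Dih T} {g : X → T} (hf : Continuous f) (hg : Continuous g) :
    Continuous fun p => symmTranslate (f p).left (symmTranslate (g p) e) := by
  have hl : Continuous fun p => (f p).left := (continuous_left T).comp hf
  have hc := continuous_symmTranslate (T := T) e
  simp only [symmTranslate_symmTranslate]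
  exact ((hc.comp (hl.mul hg)).add (hc.comp (hl.inv.mul hg))).const_smul (2⁻¹ : ℂ)

theorem continuous_evenAct_symmTranslate (a : L1 (Dih T)) (e : ZL1 (Dih T)) :
    Continuous fun t : T => evenAct a (symmTranslate t e) := by
  have h : Continuous fun p : T × Dih T => symmTranslate p.2.left (symmTranslate p.1 e) :=
    continuous_symmTranslate_left_symmTranslate e continuous_snd continuous_fst
  simp only [evenAct]
  exact continuous_integral_smul (integrable_evenWeight a)
    (F := fun t y => symmTranslate y.left (symmTranslate t e)) h

theorem continuous_elem_symmTranslate (e : ZL1 (Dih T)) :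
    Continuous fun t : T => elem (symmTranslate t e) (symmTranslate t e) :=
  continuous_elem (continuous_symmTranslate e) (continuous_symmTranslate e)

variable [MeasurableSpace T] [BorelSpace T]

/-- The convolution of the diagonal measure `μ_T` with `e ⊗ e`, written as an element of
`ZL¹ ⊗̂ ZL¹`. The contribution of `λ_D + λ_A`, which is the image of `(δ_t + δ_{t⁻¹}) ⊗ δ_t`
integrated over `T`, becomes an integral of tensors of central elements on replacing `δ_t` by
`½ (δ_t + δ_{t⁻¹})` in the second factor. -/
noncomputable def diagTensor (e : ZL1 (Dih T)) : ProjTensor (ZL1 (Dih T)) :=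
  elem (oneZ T) (oneZ T) + elem (sgnZ T) (sgnZ T) -
    (2 : ℂ) • elem (oneZ T + sgnZ T) (oneZ T + sgnZ T) +
    (2 : ℂ) • ∫ t, elem (symmTranslate t e) (symmTranslate t e) ∂(probHaar T)

theorem norm_diagTensor_le {e : ZL1 (Dih T)} (he : ‖e‖ ≤ 1) :
    ‖diagTensor e‖ ≤ ‖elem (oneZ T) (oneZ T) + elem (sgnZ T) (sgnZ T) -
      (2 : ℂ) • elem (oneZ T + sgnZ T) (oneZ T + sgnZ T)‖ + 2 := by
  refine (norm_add_le _ _).trans ?_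
  gcongr
  rw [norm_smul]
  have h : ‖∫ t, elem (symmTranslate t e) (symmTranslate t e) ∂(probHaar T)‖ ≤ 1 := by
    have h2 := norm_integral_le_of_norm_le_const (μ := probHaar T) (C := 1)
      (f := fun t => elem (symmTranslate t e) (symmTranslate t e))
      (Eventually.of_forall fun t => by
        have h3 := (norm_symmTranslate_le t e).trans he
        exact (norm_elem_le _ _).trans (mul_le_one₀ h3 (norm_nonneg _) h3))
    simpa using h2
  simpa using h

/-- In the mean over `t` of `(C_t e) ⊗ (C_t e)`, where `C_t = ½ (δ_t + δ_{t⁻¹})`, the measure `C_s`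
may act on either factor: `C_s C_t = ½ (C_{st} + C_{s⁻¹t})`, and `t ↦ s⁻¹ t` preserves Haar
measure. -/
theorem integral_elem_symmTranslate_comm (e : ZL1 (Dih T)) (s : T) :
    ∫ t, elem (symmTranslate s (symmTranslate t e)) (symmTranslate t e) ∂(probHaar T) =
      ∫ t, elem (symmTranslate t e) (symmTranslate s (symmTranslate t e)) ∂(probHaar T) := by
  have hx : ∀ r : T, Continuous fun t => symmTranslate (r * t) e := fun r =>
    (continuous_symmTranslate e).comp (continuous_const_mul r)
  have hx1 : Continuous fun t : T => symmTranslate t e := continuous_symmTranslate e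
  have hshift : ∀ r : T, ∫ t, elem (symmTranslate (r * t) e) (symmTranslate t e) ∂(probHaar T) =
      ∫ t, elem (symmTranslate t e) (symmTranslate (r⁻¹ * t) e) ∂(probHaar T) := fun r => by
    rw [← integral_mul_left_eq_self (fun t => elem (symmTranslate t e)
      (symmTranslate (r⁻¹ * t) e)) r]
    simp only [inv_mul_cancel_left]
  simp only [symmTranslate_symmTranslate, elem_smul_left, elem_smul_right, elem_add_left,
    elem_add_right]
  rw [integral_smul, integral_smul,
    integral_add (integrable_of_continuous (continuous_elem (hx s) hx1))
      (integrable_of_continuous (continuous_elem (hx s⁻¹) hx1)),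
    integral_add (integrable_of_continuous (continuous_elem hx1 (hx s)))
      (integrable_of_continuous (continuous_elem hx1 (hx s⁻¹))), hshift, hshift, inv_inv, add_comm]

/-- Squaring is a continuous surjective endomorphism of `T`, so it preserves Haar measure. -/
theorem integral_symmTranslate_sq (hsq : Function.Surjective fun t : T => t * t)
    (x : ZL1 (Dih T)) :
    ∫ t, symmTranslate (t * t) x ∂(probHaar T) = ∫ t, symmTranslate t x ∂(probHaar T) := by
  have hc : Continuous (powMonoidHom 2 : T →* T) := by
    change Continuous fun t : T => t ^ 2
    exact continuous_pow 2
  have hs : Function.Surjective (powMonoidHom 2 : T →* T) := fun t => by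
    obtain ⟨s, hs⟩ := hsq t
    exact ⟨s, by simpa [sq] using hs⟩
  have hmp := MonoidHom.measurePreserving (μ := probHaar T) (ν := probHaar T) hc hs rfl
  have h := integral_map (μ := probHaar T) hmp.measurable.aemeasurable
    (f := fun t => symmTranslate t x)
    (continuous_symmTranslate x).aestronglyMeasurable_of_compactSpace
  rw [hmp.map_eq] at h
  rw [h]
  simp only [powMonoidHom_apply, sq]

/-- The action of the part of `a` supported on `T` is symmetric in the two tensor factors, after
averaging over `T`. -/
theorem integral_elem_evenAct_comm (a : L1 (Dih T)) (e : ZL1 (Dih T)) :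
    ∫ t, elem (evenAct a (symmTranslate t e)) (symmTranslate t e) ∂(probHaar T) =
      ∫ t, elem (symmTranslate t e) (evenAct a (symmTranslate t e)) ∂(probHaar T) := by
  have hwi := integrable_evenWeight a
  have hc := continuous_symmTranslate_left_symmTranslate e (continuous_fst (X := Dih T) (Y := T))
    continuous_snd
  have hx : Continuous fun p : Dih T × T => symmTranslate p.2 e :=
    (continuous_symmTranslate e).comp continuous_snd
  simp only [elem_evenAct_left, elem_evenAct_right]
  rw [← integral_smul_integral_swap hwi
      (F := fun y t => elem (symmTranslate y.left (symmTranslate t e)) (symmTranslate t e))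
      (continuous_elem hc hx),
    ← integral_smul_integral_swap hwi
      (F := fun y t => elem (symmTranslate t e) (symmTranslate y.left (symmTranslate t e)))
      (continuous_elem hx hc)]
  simp only [integral_elem_symmTranslate_comm]

/-- The product of `diagTensor e` is `e * e`, because `C_t C_t = ½ (C_{t²} + 1)` for
`C_t = ½ (δ_t + δ_{t⁻¹})`. -/
theorem mulMap_diagTensor (hsq : Function.Surjective fun t : T => t * t) {e : ZL1 (Dih T)}
    (h1 : pair 1 (e : L1 (Dih T)) = 1) (hσ : pair (sgn T) (e : L1 (Dih T)) = 1) :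
    mulMap (ZL1 (Dih T)) (diagTensor e) = e * e := by
  have hint := integrable_of_continuous (μ := probHaar T) (continuous_elem_symmTranslate e)
  have hprod : ∀ t : T, symmTranslate t e * symmTranslate t e =
      (2⁻¹ : ℂ) • (symmTranslate (t * t) (e * e) + e * e) := by
    intro t
    rw [← symmTranslate_mul, ← symmTranslate_mul', symmTranslate_symmTranslate, inv_mul_cancel,
      symmTranslate_one]
  have hI : mulMap (ZL1 (Dih T)) (∫ t, elem (symmTranslate t e) (symmTranslate t e)
      ∂(probHaar T)) = (2⁻¹ : ℂ) • (oneZ T + sgnZ T + e * e) := by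
    rw [← (mulMap (ZL1 (Dih T))).integral_comp_comm hint]
    simp only [mulMap_elem, hprod]
    have hcs : Continuous fun t : T => symmTranslate (t * t) (e * e) :=
      (continuous_symmTranslate (e * e)).comp (continuous_id.mul continuous_id)
    rw [integral_smul, integral_add (integrable_of_continuous hcs) (integrable_const _)]
    have h2 : pair 1 ((e * e : ZL1 (Dih T)) : L1 (Dih T)) = 1 := by
      rw [NonUnitalSubalgebra.coe_mul, pair_one_mul, h1, one_mul]
    have h3 : pair (sgn T) ((e * e : ZL1 (Dih T)) : L1 (Dih T)) = 1 := by
      rw [NonUnitalSubalgebra.coe_mul, pair_sgn_mul, hσ, one_mul]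
    have h4 : ∫ t : T, symmTranslate (t * t) (e * e) ∂(probHaar T) = oneZ T + sgnZ T := by
      rw [integral_symmTranslate_sq hsq, integral_symmTranslate, h2, h3, one_smul, one_smul]
    rw [h4]
    simp
  have hone : oneZ T * oneZ T = oneZ T := by rw [mul_oneZ, pair_one_oneZ, one_smul]
  have hsgn : sgnZ T * sgnZ T = sgnZ T := by rw [mul_sgnZ, pair_sgn_sgnZ, one_smul]
  have hos : oneZ T * sgnZ T = 0 := by rw [mul_sgnZ, pair_sgn_oneZ, zero_smul]
  have hso : sgnZ T * oneZ T = 0 := by rw [ZL1.mul_comm', hos]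
  simp only [diagTensor, map_add, map_sub, map_smul, mulMap_elem, hI, add_mul, mul_add, hone, hsgn,
    hos, hso]
  module

variable [T2Space T]

/-- Every central element of `L¹(T ⋊ ℤ₂)` commutes exactly with the tensor `diagTensor e`. -/
theorem leftAct_diagTensor (hsq : Function.Surjective fun t : T => t * t) {e : ZL1 (Dih T)}
    (h1 : pair 1 (e : L1 (Dih T)) = 1) (hσ : pair (sgn T) (e : L1 (Dih T)) = 1)
    (a : ZL1 (Dih T)) : leftAct a (diagTensor e) = rightAct a (diagTensor e) := by
  have hxc : Continuous fun t : T => symmTranslate t e := continuous_symmTranslate e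
  have hPc := continuous_evenAct_symmTranslate (a : L1 (Dih T)) e
  have hxi := integrable_of_continuous (μ := probHaar T) hxc
  have hax : ∀ t, a * symmTranslate t e = evenAct (a : L1 (Dih T)) (symmTranslate t e) +
      (2⁻¹ * (pair 1 (a : L1 (Dih T)) - pair (sgn T) (a : L1 (Dih T)))) •
        (oneZ T - sgnZ T) := by
    intro t
    rw [central_mul hsq a, pair_one_symmTranslate, pair_sgn_symmTranslate, h1, hσ, one_smul,
      one_smul]
    rfl
  have hmean : ∫ t, symmTranslate t e ∂(probHaar T) = oneZ T + sgnZ T := by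
    rw [integral_symmTranslate, h1, hσ, one_smul, one_smul]
  have hL : ∫ t, elem (a * symmTranslate t e) (symmTranslate t e) ∂(probHaar T) =
      ∫ t, elem (evenAct (a : L1 (Dih T)) (symmTranslate t e)) (symmTranslate t e) ∂(probHaar T) +
        (2⁻¹ * (pair 1 (a : L1 (Dih T)) - pair (sgn T) (a : L1 (Dih T)))) •
          elem (oneZ T - sgnZ T) (oneZ T + sgnZ T) := by
    simp only [hax, elem_add_left, elem_smul_left]
    have hc := continuous_elem (continuous_const (y := oneZ T - sgnZ T)) hxc
    rw [integral_add (integrable_of_continuous (continuous_elem hPc hxc))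
      ((integrable_of_continuous hc).fun_smul _), integral_smul, ← elem_integral_right hxi, hmean]
  have hR : ∫ t, elem (symmTranslate t e) (a * symmTranslate t e) ∂(probHaar T) =
      ∫ t, elem (symmTranslate t e) (evenAct (a : L1 (Dih T)) (symmTranslate t e)) ∂(probHaar T) +
        (2⁻¹ * (pair 1 (a : L1 (Dih T)) - pair (sgn T) (a : L1 (Dih T)))) •
          elem (oneZ T + sgnZ T) (oneZ T - sgnZ T) := by
    simp only [hax, elem_add_right, elem_smul_right]
    have hc := continuous_elem hxc (continuous_const (y := oneZ T - sgnZ T))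
    rw [integral_add (integrable_of_continuous (continuous_elem hxc hPc))
      ((integrable_of_continuous hc).fun_smul _), integral_smul, ← elem_integral_left hxi, hmean]
  have hint := integrable_of_continuous (μ := probHaar T) (continuous_elem_symmTranslate e)
  have hLI : leftAct a (∫ t, elem (symmTranslate t e) (symmTranslate t e) ∂(probHaar T)) =
      ∫ t, elem (a * symmTranslate t e) (symmTranslate t e) ∂(probHaar T) := by
    rw [← (leftAct a).integral_comp_comm hint]
    simp only [leftAct_elem]
  have hRI : rightAct a (∫ t, elem (symmTranslate t e) (symmTranslate t e) ∂(probHaar T)) =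
      ∫ t, elem (symmTranslate t e) (a * symmTranslate t e) ∂(probHaar T) := by
    rw [← (rightAct a).integral_comp_comm hint]
    simp only [rightAct_elem, ZL1.mul_comm' _ a]
  have hneg : ∀ b c : ZL1 (Dih T), b - c = b + (-1 : ℂ) • c := fun b c => by module
  simp only [diagTensor, map_add, map_sub, map_smul, leftAct_elem, rightAct_elem]
  rw [hLI, hRI, hL, hR, integral_elem_evenAct_comm]
  simp only [mul_add, add_mul, ZL1.mul_comm' (oneZ T) a, ZL1.mul_comm' (sgnZ T) a, mul_oneZ,
    mul_sgnZ, hneg, elem_add_left, elem_add_right, elem_smul_left, elem_smul_right]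
  module

end Diagonal

/-! ### A central approximate identity -/

section ApproximateIdentity

variable {T : Type u} [CommGroup T] [TopologicalSpace T] [IsTopologicalGroup T] [CompactSpace T]

/-- An element of a central approximate identity: the normalised indicator function of a symmetric
neighbourhood of the identity of `T`. -/
theorem exists_central_approx {U : Set T} (hU : U ∈ 𝓝 (1 : T)) :
    ∃ e : ZL1 (Dih T), ‖e‖ ≤ 1 ∧ pair 1 (e : L1 (Dih T)) = 1 ∧
      pair (sgn T) (e : L1 (Dih T)) = 1 ∧
      ∀ (f : L1 (Dih T)) (ε : ℝ), (∀ t ∈ U, ‖translate (⟨t, 1⟩ : Dih T) f - f‖ ≤ ε) →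
        ‖(e : L1 (Dih T)) * f - f‖ ≤ ε := by
  obtain ⟨V₀, hV₀U, hV₀, h1V₀⟩ := mem_nhds_iff.1 hU
  let V : Set T := V₀ ∩ V₀⁻¹
  have hV : IsOpen V := hV₀.inter hV₀.inv
  have hVinv : ∀ t, t⁻¹ ∈ V ↔ t ∈ V := fun t => by
    simp only [V, Set.mem_inter_iff, Set.mem_inv, inv_inv, and_comm]
  let W : Set (Dih T) := {x | x.left ∈ V ∧ x.right = 1}
  have hW : IsOpen W := (hV.preimage (continuous_left T)).inter
    ((isOpen_discrete {(1 : ℤˣ)}).preimage (continuous_right T))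
  have h1W : (1 : Dih T) ∈ W := ⟨⟨h1V₀, by simpa using h1V₀⟩, rfl⟩
  have hWpos : 0 < (probHaar (Dih T)).real W := by
    rw [Measure.real, ENNReal.toReal_pos_iff]
    exact ⟨hW.measure_pos _ ⟨1, h1W⟩, measure_lt_top _ _⟩
  set c : ℝ := ((probHaar (Dih T)).real W)⁻¹ with hc
  have hcpos : 0 < c := inv_pos.2 hWpos
  let g : Dih T → ℂ := W.indicator fun _ => (c : ℂ)
  have hg : Integrable g (probHaar (Dih T)) :=
    (integrable_const _).indicator hW.measurableSet
  have hint : ∫ y, g y ∂(probHaar (Dih T)) = 1 := by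
    rw [integral_indicator_const _ hW.measurableSet, hc, Complex.real_smul, ← Complex.ofReal_mul,
      mul_inv_cancel₀ hWpos.ne', Complex.ofReal_one]
  have hnorm : ∫ y, ‖g y‖ ∂(probHaar (Dih T)) = 1 := by
    have h2 : ∀ y, ‖g y‖ = W.indicator (fun _ => c) y := fun y => by
      simp only [g, norm_indicator_eq_indicator_norm, Complex.norm_real, Real.norm_eq_abs,
        abs_of_pos hcpos]
    simp only [h2]
    rw [integral_indicator_const _ hW.measurableSet, hc, smul_eq_mul, mul_inv_cancel₀ hWpos.ne']
  have hconj : ∀ x y, x * y * x⁻¹ ∈ W ↔ y ∈ W := by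
    rintro x ⟨t, b⟩
    have hr : (x * (⟨t, b⟩ : Dih T) * x⁻¹).right = b := by
      change x.right * b * x.right⁻¹ = b
      rw [mul_right_comm, mul_inv_cancel, one_mul]
    rcases eq_or_ne b 1 with rfl | hb
    · rw [dih_conj]
      change t ^ (x.right : ℤ) ∈ V ∧ _ ↔ t ∈ V ∧ _
      rcases Int.units_eq_one_or x.right with hx | hx
      · simp [hx]
      · simp [hx, hVinv]
    · exact ⟨fun h => absurd (hr.symm.trans h.2) hb, fun h => absurd h.2 hb⟩
  have hclass : ∀ x y, g (x * y * x⁻¹) = g y := fun x y => by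
    by_cases hy : y ∈ W
    · simp only [g, Set.indicator_of_mem hy, Set.indicator_of_mem ((hconj x y).2 hy)]
    · simp only [g, Set.indicator_of_notMem hy,
        Set.indicator_of_notMem (fun h => hy ((hconj x y).1 h))]
  have hsgn : ∀ y, g y * sgn T y = g y := fun y => by
    by_cases hy : y ∈ W
    · have : sgn T y = 1 := by
        change ((y.right : ℤ) : ℂ) = 1
        rw [hy.2]
        simp
      rw [this, mul_one]
    · simp only [g, Set.indicator_of_notMem hy, zero_mul]
  refine ⟨⟨L1.mk g hg, mk_mem_ZL1 hg hclass⟩, ?_, ?_, ?_, fun f ε hε => ?_⟩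
  · change ‖L1.mk g hg‖ ≤ 1
    rw [L1.norm_mk, hnorm]
  · change pair 1 (L1.mk g hg) = 1
    rw [pair_mk]
    simpa using hint
  · change pair (sgn T) (L1.mk g hg) = 1
    rw [pair_mk]
    simpa only [hsgn] using hint
  · change ‖L1.mk g hg * f - f‖ ≤ ε
    have h2 : L1.mk g hg * f = ∫ y, g y • translate y f ∂(probHaar (Dih T)) := by
      rw [L1.mul_def]
      refine integral_congr_ae ?_
      filter_upwards [L1.fn_mk hg] with y hy
      rw [hy]
    have h3 : L1.mk g hg * f - f = ∫ y, g y • (translate y f - f) ∂(probHaar (Dih T)) := by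
      simp only [smul_sub]
      rw [integral_sub (integrable_smul_continuous hg (continuous_translate f))
        (hg.smul_const f), integral_smul_const, hint, one_smul, h2]
    rw [h3]
    calc _ ≤ ∫ y, ‖g y‖ * ε ∂(probHaar (Dih T)) := by
          refine norm_integral_le_of_norm_le (hg.norm.mul_const ε)
            (Eventually.of_forall fun y => ?_)
          rw [norm_smul]
          by_cases hy : y ∈ W
          · refine mul_le_mul_of_nonneg_left ?_ (norm_nonneg _)
            have hy2 : y = ⟨y.left, 1⟩ := SemidirectProduct.ext rfl hy.2
            rw [hy2]
            exact hε _ (hV₀U hy.1.1)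
          · simp [g, Set.indicator_of_notMem hy]
      _ = ε := by rw [integral_mul_const, hnorm, one_mul]

/-- `ZL¹(T ⋊ ℤ₂)` is amenable as soon as every element of `T` is a square. -/
theorem isAmenable_ZL1 [T2Space T] (hsq : Function.Surjective fun t : T => t * t) :
    IsAmenable (ZL1 (Dih T)) := by
  let : MeasurableSpace T := borel T
  have : BorelSpace T := ⟨rfl⟩
  have hex := fun U : (TopologicalSpace.OpenNhdsOf (1 : T))ᵒᵈ =>
    exists_central_approx (U.ofDual.isOpen.mem_nhds U.ofDual.mem)
  choose e he h1 hσ happ using hex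
  have hlim : ∀ f : ZL1 (Dih T), Tendsto (fun U => e U * f) atTop (𝓝 f) := by
    intro f
    rw [Metric.tendsto_nhds]
    intro ε hε
    have hnear : {t : T | ‖translate (⟨t, 1⟩ : Dih T) (f : L1 (Dih T)) - f‖ < ε / 2} ∈
        𝓝 (1 : T) := by
      have hcont : Continuous fun t : T =>
          ‖translate (⟨t, 1⟩ : Dih T) (f : L1 (Dih T)) - f‖ :=
        (((continuous_translate _).comp (continuous_dih_left 1)).sub continuous_const).norm
      refine (isOpen_lt hcont continuous_const).mem_nhds ?_
      have h := translate_one (f : L1 (Dih T))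
      change ‖translate (1 : Dih T) (f : L1 (Dih T)) - f‖ < ε / 2
      rw [h, sub_self, norm_zero]
      positivity
    obtain ⟨O, hO, hOo, h1O⟩ := mem_nhds_iff.1 hnear
    let U₀ : TopologicalSpace.OpenNhdsOf (1 : T) := ⟨⟨O, hOo⟩, h1O⟩
    filter_upwards [eventually_ge_atTop (OrderDual.toDual U₀)] with U hU
    have hUO : ∀ t ∈ U.ofDual, t ∈ O := fun t ht => hU ht
    rw [dist_eq_norm]
    refine lt_of_le_of_lt (happ U f (ε / 2) fun t ht => ?_) (half_lt_self hε)
    exact (hO (hUO t ht)).le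
  have hlim2 : ∀ f : ZL1 (Dih T), Tendsto (fun U => e U * e U * f) atTop (𝓝 f) := by
    intro f
    have h2 : Tendsto (fun U => e U * (e U * f - f)) atTop (𝓝 0) := by
      rw [tendsto_zero_iff_norm_tendsto_zero]
      have h3 : Tendsto (fun U => ‖e U * f - f‖) atTop (𝓝 0) :=
        tendsto_iff_norm_sub_tendsto_zero.1 (hlim f)
      refine squeeze_zero (fun _ => norm_nonneg _) (fun U => ?_) h3
      refine (norm_mul_le _ _).trans ?_
      exact mul_le_of_le_one_left (norm_nonneg _) (he U)
    have h4 := h2.add (hlim f)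
    rw [zero_add] at h4
    refine h4.congr fun U => ?_
    rw [mul_sub, sub_add_cancel, mul_assoc]
  refine ⟨_, inferInstance, inferInstance, inferInstance, fun U => diagTensor (e U),
    ⟨_, fun U => norm_diagTensor_le (he U)⟩, fun a => ⟨?_, ?_, ?_⟩⟩
  · simp only [mulMap_diagTensor hsq (h1 _) (hσ _)]
    exact hlim2 a
  · simp only [mulMap_diagTensor hsq (h1 _) (hσ _), ZL1.mul_comm' a]
    exact hlim2 a
  · simp only [leftAct_diagTensor hsq (h1 _) (hσ _), sub_self]
    exact tendsto_const_nhds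

end ApproximateIdentity

/-! ### The circle -/

/-- A real character takes the values `1` and `-1` only, and every point of the circle is a
square. -/
theorem onlyTrivialRealCharacter_circle : OnlyTrivialRealCharacter Circle := by
  intro χ hχ t
  obtain ⟨s, rfl⟩ : ∃ s : Circle, s * s = t := by
    refine ⟨Circle.exp (Complex.arg t / 2), ?_⟩
    rw [← Circle.exp_add, add_halves, Circle.exp_arg]
  have h : conj (χ s : ℂ) * (χ s : ℂ) = 1 := by
    rw [← Complex.normSq_eq_conj_mul_self]
    simp
  rw [hχ s] at h
  rw [map_mul]
  exact Circle.ext (by simpa using h)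

/-! ### Amenability, centrality and Fourier coefficients -/

theorem amenable_central_fourier {T : Type u} [CommGroup T] [TopologicalSpace T]
    [IsTopologicalGroup T] [CompactSpace T] [T2Space T] (hT : OnlyTrivialRealCharacter T) :
    IsAmenable (ZL1 (Dih T)) ∧ IsCentral (diagonalMeasure T) ∧
      ∀ π ρ : UnitaryIrrep (Dih T),
        (π.IsEquivalent ρ → fourierCoeff (diagonalMeasure T) π ρ = 1) ∧
        (¬ π.IsEquivalent ρ → fourierCoeff (diagonalMeasure T) π ρ = 0) := by
  let : MeasurableSpace T := borel T
  have : BorelSpace T := ⟨rfl⟩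
  exact ⟨isAmenable_ZL1 (surjective_mul_self hT), isCentral_diagonalMeasure, fun π ρ =>
    ⟨fourierCoeff_of_isEquivalent hT, fourierCoeff_of_not_isEquivalent hT⟩⟩

end CentreGroupAlgebra

theorem theorem1p11 :
    (CentreGroupAlgebra.IsAmenable (CentreGroupAlgebra.ZL1 (CentreGroupAlgebra.Dih Circle)) ∧
      CentreGroupAlgebra.IsCentral (CentreGroupAlgebra.diagonalMeasure Circle) ∧
      ∀ π ρ : CentreGroupAlgebra.UnitaryIrrep (CentreGroupAlgebra.Dih Circle),
        (π.IsEquivalent ρ → CentreGroupAlgebra.fourierCoeff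
          (CentreGroupAlgebra.diagonalMeasure Circle) π ρ = 1) ∧
        (¬ π.IsEquivalent ρ → CentreGroupAlgebra.fourierCoeff
          (CentreGroupAlgebra.diagonalMeasure Circle) π ρ = 0)) ∧
    ∀ (T : Type u) [CommGroup T] [TopologicalSpace T] [IsTopologicalGroup T] [CompactSpace T]
      [T2Space T], CentreGroupAlgebra.OnlyTrivialRealCharacter T →
      CentreGroupAlgebra.IsAmenable (CentreGroupAlgebra.ZL1 (CentreGroupAlgebra.Dih T)) ∧
      CentreGroupAlgebra.IsCentral (CentreGroupAlgebra.diagonalMeasure T) ∧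
      ∀ π ρ : CentreGroupAlgebra.UnitaryIrrep (CentreGroupAlgebra.Dih T),
        (π.IsEquivalent ρ → CentreGroupAlgebra.fourierCoeff
          (CentreGroupAlgebra.diagonalMeasure T) π ρ = 1) ∧
        (¬ π.IsEquivalent ρ → CentreGroupAlgebra.fourierCoeff
          (CentreGroupAlgebra.diagonalMeasure T) π ρ = 0) :=
  ⟨CentreGroupAlgebra.amenable_central_fourier
    CentreGroupAlgebra.onlyTrivialRealCharacter_circle,
    fun _ _ _ _ _ _ hT => CentreGroupAlgebra.amenable_central_fourier hT⟩
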